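/- Let $0<r<R$, $\rho\in(0,2)$, $\kappa>1$, $\delta>0$, and let $\{Y_{n,k}\}_{n\ge 0,\,1\le k\le 2n+1}$ be real spherical harmonics ($Y_{n,k}$ of degree $n$), orthonormal in $L^2$ of the unit sphere of $\mathbb R^3$. With $\nabla^*$ the surface gradient, put $y^{(1)}_{n,k}(\xi)=\xi\,Y_{n,k}(\xi)$ for $n\ge 0$ and $y^{(2)}_{n,k}(\xi)=\frac{1}{\sqrt{n(n+1)}}\nabla^*_\xi Y_{n,k}(\xi)$ for $n\ge1$, and let $0_1=0$, $0_2=1$, $\sigma_n=(r/R)^{n+1}$, $u\otimes v=uv^T$. For $N\in\mathbb N$ and real symbols $\mathbf\Phi_N^\wedge(n)$ ($0\le n\le N$) and $\tilde{\mathbf\Phi}_N^\wedge(n)$ ($0\le n\le\lfloor\kappa N\rfloor$), extended by $0$ to larger $n$, let $\tilde{\mathbf\Psi}_N^\wedge(n)=\tilde{\mathbf\Phi}_N^\wedge(n)-\mathbf\Phi_N^\wedge(n)\sigma_n$ and, for $|x|=|y|=r$, $\xi=x/|x|$, $\eta=y/|y|$, let $$\tilde{\mathbf\Psi}_N(x,y)=\sum_{i=1}^2\sum_{n=0_i}^{\lfloor\kappa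 N\rfloor}\sum_{k=1}^{2n+1}\tilde{\mathbf\Psi}_N^\wedge(n)\,\tfrac1r y^{(i)}_{n,k}(\xi)\otimes\tfrac1r y^{(i)}_{n,k}(\eta).$$ The Frobenius norm $|\tilde{\mathbf\Psi}_N(x,y)|$ depends only on $t=\xi\cdot\eta\in[-1,1]$; for $-1\le b\le 1$, $\|\tilde{\mathbf\Psi}_N\|^2_{L^2([-1,b])}$ denotes the integral over $t\in[-1,b]$ of $|\tilde{\mathbf\Psi}_N|^2$ as a function of $t$. Let $\alpha_{N,n}$, $\tilde\alpha_{N,n}$ ($0\le n\le\lfloor\kappa N\rfloor$) and $\beta_N$ be positive and suppose that, as $N\to\infty$, $$\max_{n=0,\ldots,\lfloor\kappa N\rfloor}\frac{\beta_N\frac{1-(R/r)^{2(N+1)}}{1-(R/r)^2}+(\lfloor\kappa N\rfloor+1)^2}{\alpha_{N,n}}=\mathcal O\big(N^{-2(1+\delta)}\big),$$ and that the same holds with $\tilde\alpha_{N,n}$ in place of $\alpha_{N,n}$. For every $N$, let the symbols $\mathbf\Phi_N^\wedge(n)$ and $\tilde{\mathbf\Phi}_N^\wedge(n)$ minimize,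 among all such symbols, $$\mathcal F=\sum_{n=0}^{\lfloor\kappa N\rfloor}\tilde\alpha_{N,n}\big|1-\tilde{\mathbf\Phi}_N^\wedge(n)\big|^2+\sum_{n=0}^{N}\alpha_{N,n}\big|1-\mathbf\Phi_N^\wedge(n)\sigma_n\big|^2+\beta_N\sum_{n=0}^N\big|\mathbf\Phi_N^\wedge(n)\big|^2+8\pi^2r^4\big\|\tilde{\mathbf\Psi}_N\big\|^2_{L^2([-1,1-\rho])}.$$ Then $\|\tilde{\mathbf\Psi}_N\|_{L^2([-1,1])}>0$ for all sufficiently large $N$, and $$\lim_{N\to\infty}\frac{\big\|\tilde{\mathbf\Psi}_N\big\|^2_{L^2([-1,1-\rho])}}{\big\|\tilde{\mathbf\Psi}_N\big\|^2_{L^2([-1,1])}}=0.$$ -/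

import Mathlib

open Filter Asymptotics MeasureTheory
open scoped Topology

noncomputable section

/-- Euclidean space `ℝ³`. -/
abbrev E3 : Type := EuclideanSpace ℝ (Fin 3)

/-- `F` is, on the unit sphere, a spherical harmonic of degree `n`: the restriction of a
homogeneous polynomial of degree `n` whose Laplacian vanishes. -/
def IsSphericalHarmonic (n : ℕ) (F : E3 → ℝ) : Prop :=
  ∃ p : MvPolynomial (Fin 3) ℝ,
    p.IsHomogeneous n ∧
    ∑ i : Fin 3, MvPolynomial.pderiv i (MvPolynomial.pderiv i p) = 0 ∧
    ∀ ξ : E3, ‖ξ‖ = 1 → F ξ = MvPolynomial.eval (fun i => ξ i) p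

/-- `Y n k`, with `n = 0, 1, …` and `2 n + 1` indices `k` for each `n`, is a set of spherical
harmonics, `Y n k` of degree `n`, that is orthonormal with respect to the surface measure of
the unit sphere (of total mass `4 π`). Only the values on the unit sphere matter. -/
structure IsOrthonormalSphericalHarmonics (Y : (n : ℕ) → Fin (2 * n + 1) → E3 → ℝ) : Prop where
  harmonic : ∀ n k, IsSphericalHarmonic n (Y n k)
  orthonormal : ∀ p q : (n : ℕ) × Fin (2 * n + 1),
    ∫ ξ : Metric.sphere (0 : E3) 1, Y p.1 p.2 ξ * Y q.1 q.2 ξ ∂(volume : Measure E3).toSphere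
      = if p = q then 1 else 0

/-- The surface gradient `∇*` at the unit vector `ξ` of a function `F` on the unit sphere: the
gradient at `ξ` of the extension of `F` that is constant along rays, `x ↦ F (x / |x|)`. -/
def surfaceGradient (F : E3 → ℝ) (ξ : E3) : E3 :=
  gradient (fun x : E3 => F (‖x‖⁻¹ • x)) ξ

/-- The vector spherical harmonics of type 1, `ξ Y_{n,k}(ξ)`. -/
def vecHarmonic₁ (Y : (n : ℕ) → Fin (2 * n + 1) → E3 → ℝ) (n : ℕ) (k : Fin (2 * n + 1))
    (ξ : E3) : E3 :=
  Y n k ξ • ξ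

/-- The vector spherical harmonics of type 2, `(n (n + 1))^{-1/2} ∇* Y_{n,k}(ξ)`, `n ≥ 1`. -/
def vecHarmonic₂ (Y : (n : ℕ) → Fin (2 * n + 1) → E3 → ℝ) (n : ℕ) (k : Fin (2 * n + 1))
    (ξ : E3) : E3 :=
  (1 / Real.sqrt ((n : ℝ) * ((n : ℝ) + 1))) • surfaceGradient (Y n k) ξ

/-- The tensor product `u ⊗ v = u vᵀ`. -/
def tensor (u v : E3) : Matrix (Fin 3) (Fin 3) ℝ :=
  Matrix.of fun i j => u i * v j

/-- The squared absolute value `|A|² = ∑ᵢⱼ Aᵢⱼ²` of a tensor. -/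
def tensorAbsSq (A : Matrix (Fin 3) (Fin 3) ℝ) : ℝ :=
  ∑ i, ∑ j, A i j ^ 2

/-- The bandlimited tensor kernel on `Ω_r × Ω_r` with symbols `ψ n`, `0 ≤ n ≤ L`:
`∑ᵢ ∑_{n = 0_i}^{L} ∑ₖ ψ(n) (1/r) y⁽ⁱ⁾_{n,k}(x/|x|) ⊗ (1/r) y⁽ⁱ⁾_{n,k}(y/|y|)`,
with `i = 1, 2`, `0_1 = 0` and `0_2 = 1`. -/
def tensorKernel (Y : (n : ℕ) → Fin (2 * n + 1) → E3 → ℝ) (r : ℝ) (L : ℕ) (ψ : ℕ → ℝ)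
    (x y : E3) : Matrix (Fin 3) (Fin 3) ℝ :=
  (∑ n ∈ Finset.Icc 0 L, ∑ k : Fin (2 * n + 1),
    ψ n • tensor ((1 / r) • vecHarmonic₁ Y n k (‖x‖⁻¹ • x))
      ((1 / r) • vecHarmonic₁ Y n k (‖y‖⁻¹ • y))) +
  ∑ n ∈ Finset.Icc 1 L, ∑ k : Fin (2 * n + 1),
    ψ n • tensor ((1 / r) • vecHarmonic₂ Y n k (‖x‖⁻¹ • x))
      ((1 / r) • vecHarmonic₂ Y n k (‖y‖⁻¹ • y))

/-- For a tensor-zonal kernel `K` on `Ω_r × Ω_r`, i.e. one for which `|K(x, y)|` depends only on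
`t = (x/|x|) · (y/|y|)`, this is `|K|²` as a function of `t ∈ [-1, 1]`. It is read off at the
points `x = r e₃` and `y = r (√(1 - t²) e₁ + t e₃)` of `Ω_r`. -/
def zonalAbsSq (r : ℝ) (K : E3 → E3 → Matrix (Fin 3) (Fin 3) ℝ) (t : ℝ) : ℝ :=
  tensorAbsSq (K (r • !₂[0, 0, 1]) (r • !₂[Real.sqrt (1 - t ^ 2), 0, t]))

/-- The squared norm `‖K‖²_{L²([-1, b])} = ∫_{-1}^{b} |K|² dt` of a tensor-zonal kernel on
`Ω_r × Ω_r`. -/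
def zonalNormSq (r : ℝ) (K : E3 → E3 → Matrix (Fin 3) (Fin 3) ℝ) (b : ℝ) : ℝ :=
  ∫ t in (-1 : ℝ)..b, zonalAbsSq r K t

/-- The singular values `σ_n = (r / R)^(n + 1)` of vectorial upward continuation. -/
def singularValue (r R : ℝ) (n : ℕ) : ℝ :=
  (r / R) ^ (n + 1)

/-- The symbols of the wavelet kernel, `Ψ̃^(n) = Φ̃^(n) - Φ^(n) σ_n`. -/
def waveletSymbol (r R : ℝ) (φ φt : ℕ → ℝ) (n : ℕ) : ℝ :=
  φt n - φ n * singularValue r R n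

/-- The tensor wavelet kernel of degree `⌊κ N⌋` determined by the symbols `φ` of the scaling
kernel and the auxiliary symbols `φt`. -/
def waveletKernel (Y : (n : ℕ) → Fin (2 * n + 1) → E3 → ℝ) (r R κ : ℝ) (N : ℕ)
    (φ φt : ℕ → ℝ) : E3 → E3 → Matrix (Fin 3) (Fin 3) ℝ :=
  tensorKernel Y r ⌊κ * N⌋₊ (waveletSymbol r R φ φt)

/-- The functional `𝓕`, in terms of the symbols `φ` of `Φ_N` and the auxiliary symbols `φt`, with
parameters `α n = α_{N,n}`, `αt n = α̃_{N,n}`, `β = β_N`. -/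
def kernelFunctional (Y : (n : ℕ) → Fin (2 * n + 1) → E3 → ℝ) (r R ρ κ : ℝ) (N : ℕ)
    (α αt : ℕ → ℝ) (β : ℝ) (φ φt : ℕ → ℝ) : ℝ :=
  ∑ n ∈ Finset.Icc 0 ⌊κ * N⌋₊, αt n * |1 - φt n| ^ 2
    + ∑ n ∈ Finset.Icc 0 N, α n * |1 - φ n * singularValue r R n| ^ 2
    + β * ∑ n ∈ Finset.Icc 0 N, |φ n| ^ 2
    + 8 * Real.pi ^ 2 * r ^ 4 * zonalNormSq r (waveletKernel Y r R κ N φ φt) (1 - ρ)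

/-- The admissible symbols: `Φ_N` has degree at most `N`, and `Φ̃_N^(n)` (hence `Ψ̃_N^(n)`)
vanishes for `n > ⌊κ N⌋`. -/
def admissibleSymbols (κ : ℝ) (N : ℕ) : Set ((ℕ → ℝ) × (ℕ → ℝ)) :=
  {p | (∀ n, N < n → p.1 n = 0) ∧ ∀ n, ⌊κ * N⌋₊ < n → p.2 n = 0}

/-- The symbols `(φ, φt)` minimize the functional `𝓕` among all admissible symbols. -/
def IsMinimizer (Y : (n : ℕ) → Fin (2 * n + 1) → E3 → ℝ) (r R ρ κ : ℝ) (N : ℕ)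
    (α αt : ℕ → ℝ) (β : ℝ) (φ φt : ℕ → ℝ) : Prop :=
  (φ, φt) ∈ admissibleSymbols κ N ∧
  IsMinOn (fun p : (ℕ → ℝ) × (ℕ → ℝ) => kernelFunctional Y r R ρ κ N α αt β p.1 p.2)
    (admissibleSymbols κ N) (φ, φt)

/-- The maximum over `n = 0, …, ⌊κ N⌋` of
`(β_N (1 - (R/r)^(2(N+1))) / (1 - (R/r)²) + (⌊κ N⌋ + 1)²) / α_{N,n}`. -/
def growthRatio (r R κ : ℝ) (β : ℕ → ℝ) (α : ℕ → ℕ → ℝ) (N : ℕ) : ℝ :=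
  (Finset.range (⌊κ * N⌋₊ + 1)).sup' Finset.nonempty_range_add_one fun n =>
    (β N * ((1 - (R / r) ^ (2 * (N + 1))) / (1 - (R / r) ^ 2)) + ((⌊κ * N⌋₊ : ℝ) + 1) ^ 2)
      / α N n

end

/-! The minimizer is compared with a sharp bandpass filter. Put `L = ⌊κN⌋`. The symbols `Φ^(n) =
1/σ_n` for `n ≤ N` and `Φ̃^(n) = 1` for `n ≤ L` annihilate the first two sums of the functional. Its
`β`-term is then a geometric sum in `(R/r)²`, and its kernel term is `O((L+1)²)`. Hence the minimum
is at most a constant times the numerator in `growthRatio` (`kernelFunctional_minimizer_le`). Each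
summand of the first two sums is bounded by this minimum; dividing by the weights, the minimizing
wavelet symbols differ from the indicator of `N < n ≤ L` by a uniform error with square `ε_N → 0`
(`sq_waveletSymbol_sub_sharpSymbol_le`).

It remains to estimate kernels. The addition theorem and its derivatives along great circles write
`|K|²` as a constant times a sum of squares of three polynomials in `t`: the normal, cross and along
profiles (`zonalAbsSq_tensorKernel`). The constant contains the area of the sphere, whose value is
irrelevant because it cancels in the quotient.

The denominator is at least its normal part, which Parseval bounds below by a multiple of `N²`,
because `κ > 1` leaves order `N²` harmonics in the band (`le_integral_profileSq`). In the numerator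
the symbol is split into the indicator and the error. The error contributes at most a multiple of
`ε_N L²`, with no use of localization (`integral_profileSq_le`). The indicator contributes only
`O(L)`: multiplied by `1 - t`, its profiles telescope by Christoffel–Darboux to boundary terms of
squared norm `O(L)`, and `1 - t ≥ ρ` on the interval (`integral_profileSq_sharp_le`). The quotient
is therefore `O(1/N + ε_N)`.

The addition theorem itself comes from uniqueness of zonal harmonics: rotations act on the
orthonormal basis by orthogonal matrices, so the reproducing kernel is invariant, and an invariant
harmonic is determined by its value at the pole. -/

/-! ### Legendre polynomials -/

namespace LegendrePolynomial

open Polynomial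

/-- The Legendre polynomials, by Bonnet's recurrence. -/
noncomputable def legendre : ℕ → ℝ[X]
  | 0 => 1
  | 1 => X
  | n + 2 => C ((n + 2 : ℝ)⁻¹) *
      (C (2 * n + 3 : ℝ) * X * legendre (n + 1) - C (n + 1 : ℝ) * legendre n)

theorem legendre_zero : legendre 0 = 1 := by rw [legendre]

theorem legendre_one : legendre 1 = X := by rw [legendre]

theorem legendre_rec (n : ℕ) :
    ((n : ℝ[X]) + 2) * legendre (n + 2) =
      (2 * (n : ℝ[X]) + 3) * X * legendre (n + 1) - ((n : ℝ[X]) + 1) * legendre n := by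
  rw [legendre, ← mul_assoc]
  have h : ((n : ℝ[X]) + 2) * C ((n + 2 : ℝ)⁻¹) = 1 := by
    have : ((n : ℝ[X]) + 2) = C (n + 2 : ℝ) := by simp [map_ofNat C 2]
    rw [this, ← C_mul, mul_inv_cancel₀ (by positivity), C_1]
  rw [h]
  simp [map_ofNat C 2, map_ofNat C 3]

theorem natCast_add_ne_zero (n k : ℕ) : ((n : ℝ[X]) + (k + 1 : ℕ)) ≠ 0 := by
  exact_mod_cast (Nat.succ_ne_zero (n + k))

/-- The two relations go through one induction: the first at `n + 1` comes from the differentiated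
recurrence and the second at `n`; the second at `n + 1` then follows algebraically from all of them.
-/
theorem derivative_legendre_aux (n : ℕ) :
    derivative (legendre (n + 1)) - X * derivative (legendre n)
        = ((n : ℝ[X]) + 1) * legendre n ∧
      X * derivative (legendre (n + 1)) - derivative (legendre n)
        = ((n : ℝ[X]) + 1) * legendre (n + 1) := by
  induction n with
  | zero => simp [legendre_zero, legendre_one]
  | succ n ih =>
    obtain ⟨hA, hB⟩ := ih
    have hr := legendre_rec n
    have hd := congrArg derivative hr
    simp only [derivative_mul, derivative_add, derivative_sub, derivative_natCast,
      derivative_ofNat, derivative_X, derivative_one] at hd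
    have h0 := natCast_add_ne_zero n 1
    push_cast at h0 ⊢
    have hA' : derivative (legendre (n + 2)) - X * derivative (legendre (n + 1))
        = ((n : ℝ[X]) + 1 + 1) * legendre (n + 1) := by
      apply mul_left_cancel₀ h0
      linear_combination hd + ((n : ℝ[X]) + 1) * hB
    refine ⟨hA', ?_⟩
    linear_combination X * hA' - hA + X * hB - hr

theorem derivative_legendre_succ (n : ℕ) :
    derivative (legendre (n + 1)) = X * derivative (legendre n) + ((n : ℝ[X]) + 1) * legendre n := by
  linear_combination (derivative_legendre_aux n).1

theorem X_mul_derivative_legendre_succ (n : ℕ) :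
    X * derivative (legendre (n + 1)) =
      derivative (legendre n) + ((n : ℝ[X]) + 1) * legendre (n + 1) := by
  linear_combination (derivative_legendre_aux n).2

theorem one_sub_sq_mul_derivative_legendre (n : ℕ) :
    (1 - X ^ 2) * derivative (legendre (n + 1)) =
      ((n : ℝ[X]) + 1) * (legendre n - X * legendre (n + 1)) := by
  linear_combination derivative_legendre_succ n - X * X_mul_derivative_legendre_succ n

/-- Legendre's differential equation in divergence form. -/
theorem derivative_one_sub_sq_mul_derivative_legendre (n : ℕ) :
    derivative ((1 - X ^ 2) * derivative (legendre n)) =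
      -((n : ℝ[X]) * ((n : ℝ[X]) + 1)) * legendre n := by
  cases n with
  | zero => simp [legendre_zero]
  | succ n =>
    rw [one_sub_sq_mul_derivative_legendre]
    simp only [derivative_mul, derivative_add, derivative_sub, derivative_natCast,
      derivative_X, derivative_one]
    push_cast
    linear_combination -((n : ℝ[X]) + 1) * X_mul_derivative_legendre_succ n

/-- Legendre's differential equation. -/
theorem legendre_ode (n : ℕ) :
    (1 - X ^ 2) * derivative (derivative (legendre n)) - 2 * X * derivative (legendre n) =
      -((n : ℝ[X]) * ((n : ℝ[X]) + 1)) * legendre n := by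
  rw [← derivative_one_sub_sq_mul_derivative_legendre, derivative_mul]
  simp only [derivative_sub, derivative_one, derivative_X_pow]
  simp [map_ofNat C 2]
  ring

theorem derivative_legendre_add_two (n : ℕ) :
    derivative (legendre (n + 2)) =
      derivative (legendre n) + (2 * (n : ℝ[X]) + 3) * legendre (n + 1) := by
  have h1 := derivative_legendre_succ (n + 1)
  push_cast at h1
  linear_combination h1 + X_mul_derivative_legendre_succ n

theorem one_sub_sq_mul_derivative_legendre' (n : ℕ) :
    (2 * (n : ℝ[X]) + 3) * ((1 - X ^ 2) * derivative (legendre (n + 1))) =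
      ((n : ℝ[X]) + 1) * ((n : ℝ[X]) + 2) * (legendre n - legendre (n + 2)) := by
  linear_combination (2 * (n : ℝ[X]) + 3) * one_sub_sq_mul_derivative_legendre n
    + ((n : ℝ[X]) + 1) * legendre_rec n

/-- The Christoffel–Darboux formula at the point `1`. -/
theorem one_sub_X_mul_sum_legendre (n : ℕ) :
    (1 - X) * ∑ j ∈ Finset.range (n + 1), (2 * (j : ℝ[X]) + 1) * legendre j =
      ((n : ℝ[X]) + 1) * (legendre n - legendre (n + 1)) := by
  induction n with
  | zero => simp [legendre_zero, legendre_one]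
  | succ n ih =>
    rw [Finset.sum_range_succ, mul_add, ih]
    push_cast
    linear_combination legendre_rec n

/-- The Christoffel–Darboux formula at the point `-1`. -/
theorem one_add_X_mul_sum_legendre (n : ℕ) :
    (1 + X) * ∑ j ∈ Finset.range (n + 1), (-1) ^ (n + j) * ((2 * (j : ℝ[X]) + 1) * legendre j) =
      ((n : ℝ[X]) + 1) * (legendre n + legendre (n + 1)) := by
  induction n with
  | zero => simp [legendre_zero, legendre_one]
  | succ n ih =>
    have h : ∑ j ∈ Finset.range (n + 1),
        (-1) ^ (n + 1 + j) * ((2 * (j : ℝ[X]) + 1) * legendre j) =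
        - ∑ j ∈ Finset.range (n + 1), (-1) ^ (n + j) * ((2 * (j : ℝ[X]) + 1) * legendre j) := by
      rw [← Finset.sum_neg_distrib]
      refine Finset.sum_congr rfl fun j _ => ?_
      ring
    rw [Finset.sum_range_succ, h, ← two_mul, pow_mul]
    push_cast
    linear_combination -ih - legendre_rec n

theorem legendre_eval_one (n : ℕ) : (legendre n).eval 1 = 1 := by
  have h : (legendre n).eval 1 = 1 ∧ (legendre (n + 1)).eval 1 = 1 := by
    induction n with
    | zero => simp [legendre_zero, legendre_one]
    | succ n ih =>
      refine ⟨ih.2, ?_⟩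
      have hr := congrArg (eval 1) (legendre_rec n)
      simp only [eval_mul, eval_add, eval_sub, eval_natCast, eval_ofNat, eval_X, eval_one,
        ih.1, ih.2] at hr
      have h0 : (n : ℝ) + 2 ≠ 0 := by positivity
      apply mul_left_cancel₀ h0
      linear_combination hr
  exact h.1

/-! ### Integrals over `[-1, 1]` -/

/-- The integral of a polynomial over `[-1, 1]`. -/
noncomputable def integralUnit (p : ℝ[X]) : ℝ := ∫ t in (-1 : ℝ)..1, p.eval t

theorem intervalIntegrable_eval (p : ℝ[X]) (a b : ℝ) :
    IntervalIntegrable (fun t => p.eval t) volume a b :=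
  p.continuous.intervalIntegrable a b

theorem integral_add (p q : ℝ[X]) : integralUnit (p + q) = integralUnit p + integralUnit q := by
  simp only [integralUnit, eval_add]
  exact intervalIntegral.integral_add (intervalIntegrable_eval _ _ _) (intervalIntegrable_eval _ _ _)

theorem integral_sub (p q : ℝ[X]) : integralUnit (p - q) = integralUnit p - integralUnit q := by
  simp only [integralUnit, eval_sub]
  exact intervalIntegral.integral_sub (intervalIntegrable_eval _ _ _) (intervalIntegrable_eval _ _ _)

theorem integral_C_mul (a : ℝ) (p : ℝ[X]) : integralUnit (C a * p) = a * integralUnit p := by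
  simp [integralUnit]

theorem integral_zero : integralUnit 0 = 0 := by simp [integralUnit]

theorem integral_sum {ι : Type*} (s : Finset ι) (f : ι → ℝ[X]) :
    integralUnit (∑ i ∈ s, f i) = ∑ i ∈ s, integralUnit (f i) := by
  classical
  induction s using Finset.induction_on with
  | empty => simp [integral_zero]
  | insert i s hi ih => rw [Finset.sum_insert hi, Finset.sum_insert hi, integral_add, ih]

theorem integral_derivative (p : ℝ[X]) : integralUnit (derivative p) = p.eval 1 - p.eval (-1) :=
  intervalIntegral.integral_eq_sub_of_hasDerivAt (fun t _ => p.hasDerivAt t)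
    (intervalIntegrable_eval _ _ _)

theorem integral_mono {p q : ℝ[X]} (h : ∀ t ∈ Set.Icc (-1 : ℝ) 1, p.eval t ≤ q.eval t) :
    integralUnit p ≤ integralUnit q :=
  intervalIntegral.integral_mono_on (by norm_num) (intervalIntegrable_eval _ _ _)
    (intervalIntegrable_eval _ _ _) h

theorem integral_natCast_mul (a : ℕ) (p : ℝ[X]) : integralUnit ((a : ℝ[X]) * p) = a * integralUnit p := by
  rw [← integral_C_mul]; simp

/-- Sturm–Liouville argument: the derivative of `(1 - t²)(P_n' P_m - P_m' P_n)` is the difference of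
the eigenvalues times `P_m P_n`, and the factor `1 - t²` kills the boundary terms. -/
theorem integral_legendre_mul_of_ne {m n : ℕ} (h : m ≠ n) :
    integralUnit (legendre m * legendre n) = 0 := by
  have h1 := integral_derivative ((1 - X ^ 2) *
    (derivative (legendre n) * legendre m - derivative (legendre m) * legendre n))
  have h2 : derivative ((1 - X ^ 2) *
      (derivative (legendre n) * legendre m - derivative (legendre m) * legendre n)) =
      C ((m : ℝ) * (m + 1) - n * (n + 1)) * (legendre m * legendre n) := by
    have e1 := derivative_one_sub_sq_mul_derivative_legendre n
    have e2 := derivative_one_sub_sq_mul_derivative_legendre m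
    rw [derivative_mul] at e1 e2 ⊢
    simp only [derivative_sub, derivative_mul]
    simp only [derivative_sub] at e1 e2
    simp only [map_sub, map_mul, map_add, C_1, map_natCast]
    linear_combination legendre m * e1 - legendre n * e2
  rw [h2, integral_C_mul] at h1
  simp only [eval_mul, eval_sub, eval_pow, eval_X, eval_one] at h1
  norm_num at h1
  rcases h1 with h1 | h1
  · exfalso
    have h3 : ((m : ℝ) - n) * (m + n + 1) = 0 := by linear_combination h1
    rcases mul_eq_zero.1 h3 with h4 | h4
    · exact h (by exact_mod_cast sub_eq_zero.1 h4)
    · have : (0 : ℝ) < (m : ℝ) + n + 1 := by positivity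
      linarith
  · exact h1

/-- Evaluating `∫ t P_n P_{n+1}` by Bonnet's recurrence, once for `t P_n` and once for `t P_{n+1}`,
gives the ratio of consecutive norms. -/
theorem integral_legendre_sq (n : ℕ) : integralUnit (legendre n ^ 2) = 2 / (2 * n + 1) := by
  induction n with
  | zero => simp [legendre_zero, integralUnit]; norm_num
  | succ n ih =>
    -- At `k = 0` the truncated index `k - 1` is harmless, since its coefficient is `k`.
    have hodd : ∀ k : ℕ, (2 * (k : ℝ[X]) + 1) * (X * (legendre k * legendre (k + 1))) =
        ((k : ℝ[X]) + 1) * legendre (k + 1) ^ 2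
          + (k : ℝ[X]) * (legendre (k - 1) * legendre (k + 1)) := by
      rintro (_ | k)
      · simp [legendre_zero, legendre_one]; ring
      · have := legendre_rec k
        push_cast
        linear_combination -legendre (k + 2) * this
    have h1 : (2 * (n : ℝ) + 1) * integralUnit (X * (legendre n * legendre (n + 1))) =
        (n + 1) * integralUnit (legendre (n + 1) ^ 2) := by
      have := congrArg integralUnit (hodd n)
      rw [integral_add, integral_natCast_mul, integral_legendre_mul_of_ne (by omega)] at this
      have e1 : (2 * (n : ℝ[X]) + 1) = ((2 * n + 1 : ℕ) : ℝ[X]) := by push_cast; ring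
      have e2 : ((n : ℝ[X]) + 1) = ((n + 1 : ℕ) : ℝ[X]) := by push_cast; ring
      rw [e1, e2, integral_natCast_mul, integral_natCast_mul] at this
      push_cast at this
      linarith
    have h2 : (2 * (n : ℝ) + 3) * integralUnit (X * (legendre n * legendre (n + 1))) =
        (n + 1) * integralUnit (legendre n ^ 2) := by
      have h : ((2 * n + 3 : ℕ) : ℝ[X]) * (X * (legendre n * legendre (n + 1))) =
        ((n + 1 : ℕ) : ℝ[X]) * legendre n ^ 2
          + ((n + 2 : ℕ) : ℝ[X]) * (legendre n * legendre (n + 2)) := by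
        push_cast
        linear_combination -legendre n * legendre_rec n
      have := congrArg integralUnit h
      rw [integral_add, integral_natCast_mul, integral_natCast_mul, integral_natCast_mul,
        integral_legendre_mul_of_ne (by omega)] at this
      push_cast at this
      linarith
    rw [ih] at h2
    push_cast
    have p1 : (0 : ℝ) < 2 * n + 1 := by positivity
    have p2 : (0 : ℝ) < 2 * n + 3 := by positivity
    have p3 : (0 : ℝ) < n + 1 := by positivity
    have h3 : integralUnit (X * (legendre n * legendre (n + 1))) =
        (n + 1) * (2 / (2 * n + 1)) / (2 * n + 3) := by
      rw [eq_div_iff p2.ne', mul_comm]; exact h2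
    rw [h3] at h1
    have h4 : integralUnit (legendre (n + 1) ^ 2) =
      (2 * (n : ℝ) + 1) * ((n + 1) * (2 / (2 * n + 1)) / (2 * n + 3)) / (n + 1) := by
      rw [eq_div_iff p3.ne', mul_comm]; exact h1.symm
    rw [h4, show 2 * ((n : ℝ) + 1) + 1 = 2 * n + 3 by ring]
    field_simp

/-- Parseval's identity for finite Legendre expansions. -/
theorem integral_sum_legendre_sq (s : Finset ℕ) (a : ℕ → ℝ) :
    integralUnit ((∑ n ∈ s, C (a n) * legendre n) ^ 2) = ∑ n ∈ s, a n ^ 2 * (2 / (2 * n + 1)) := by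
  rw [sq, Finset.sum_mul_sum, integral_sum]
  refine Finset.sum_congr rfl fun m hm => ?_
  rw [integral_sum, Finset.sum_eq_single m]
  · rw [show C (a m) * legendre m * (C (a m) * legendre m) = C (a m ^ 2) * legendre m ^ 2 by
      rw [C_pow]; ring, integral_C_mul, integral_legendre_sq]
  · intro n _ hn
    rw [show C (a m) * legendre m * (C (a n) * legendre n) =
      C (a m * a n) * (legendre m * legendre n) by rw [C_mul]; ring, integral_C_mul,
      integral_legendre_mul_of_ne hn.symm, mul_zero]
  · exact fun h => absurd hm h

/-- Stepping down by two, `P_m'` is a combination of Legendre polynomials of degree below `m ≤ n`,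
all orthogonal to `P_n`. -/
theorem integral_legendre_mul_derivative {m n : ℕ} (h : m ≤ n) :
    integralUnit (legendre n * derivative (legendre m)) = 0 := by
  induction m using Nat.strong_induction_on with
  | _ m ih =>
    match m, h, ih with
    | 0, _, _ => simp [legendre_zero, integral_zero]
    | 1, h, _ =>
      have := integral_legendre_mul_of_ne (m := n) (n := 0) (by omega)
      simpa [legendre_one, legendre_zero] using this
    | m + 2, h, ih =>
      have e : legendre n * derivative (legendre (m + 2)) =
          legendre n * derivative (legendre m)
            + ((2 * m + 3 : ℕ) : ℝ[X]) * (legendre n * legendre (m + 1)) := by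
        rw [derivative_legendre_add_two]; push_cast; ring
      rw [e, integral_add, integral_natCast_mul, ih m (by omega) (by omega),
        integral_legendre_mul_of_ne (by omega), mul_zero, add_zero]

/-- Squaring `P_{n+2}' = P_n' + (2n+3) P_{n+1}`, the cross term integrates to zero and the last
square adds `2(2n+3)`. -/
theorem integral_derivative_legendre_sq (n : ℕ) :
    integralUnit (derivative (legendre n) ^ 2) = n * (n + 1) := by
  induction n using Nat.strong_induction_on with
  | _ n ih =>
    match n, ih with
    | 0, _ => simp [legendre_zero, integral_zero]
    | 1, _ => simp [legendre_one, integralUnit]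
    | n + 2, ih =>
      have e : derivative (legendre (n + 2)) ^ 2 = derivative (legendre n) ^ 2
          + ((2 * (2 * n + 3) : ℕ) : ℝ[X]) * (legendre (n + 1) * derivative (legendre n))
          + (((2 * n + 3) ^ 2 : ℕ) : ℝ[X]) * legendre (n + 1) ^ 2 := by
        rw [derivative_legendre_add_two]; push_cast; ring
      rw [e, integral_add, integral_add, integral_natCast_mul, integral_natCast_mul,
        ih n (by omega), integral_legendre_mul_derivative (by omega), integral_legendre_sq]
      push_cast
      have p : (0 : ℝ) < 2 * ((n : ℝ) + 1) + 1 := by positivity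
      field_simp
      ring

end LegendrePolynomial

/-! ### Zonal profiles of bandlimited tensor kernels -/

namespace LegendrePolynomial

open Polynomial

/-- The normal-normal component of the kernel with symbols `ψ`. -/
noncomputable def normalProfile (L : ℕ) (ψ : ℕ → ℝ) : ℝ[X] :=
  ∑ n ∈ Finset.Icc 0 L, C (ψ n * (2 * n + 1)) * legendre n

/-- The tangential component of the kernel with symbols `ψ`, orthogonal to the great circle. -/
noncomputable def crossProfile (L : ℕ) (ψ : ℕ → ℝ) : ℝ[X] :=
  ∑ n ∈ Finset.Icc 1 L, C (ψ n * ((2 * n + 1) / (n * (n + 1)))) * derivative (legendre n)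

/-- The tangential component of the kernel with symbols `ψ`, along the great circle. -/
noncomputable def alongProfile (L : ℕ) (ψ : ℕ → ℝ) : ℝ[X] :=
  (∑ n ∈ Finset.Icc 1 L, C (ψ n * (2 * n + 1)) * legendre n) - X * crossProfile L ψ

/-- The squared Frobenius norm of the kernel with symbols `ψ`, up to a constant. -/
noncomputable def profileSq (L : ℕ) (ψ : ℕ → ℝ) : ℝ[X] :=
  normalProfile L ψ ^ 2 + crossProfile L ψ ^ 2 + alongProfile L ψ ^ 2

/-- Legendre's equation trades `P_n''` for `P_n`. The right-hand form is what differentiating the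
addition theorem produces; the defining form has no second derivatives and can be estimated by
Parseval. -/
theorem alongProfile_eq (L : ℕ) (ψ : ℕ → ℝ) :
    alongProfile L ψ = X * crossProfile L ψ
      - (1 - X ^ 2) * derivative (crossProfile L ψ) := by
  have h : (1 - X ^ 2) * derivative (crossProfile L ψ) = 2 * X * crossProfile L ψ
      - ∑ n ∈ Finset.Icc 1 L, C (ψ n * (2 * n + 1)) * legendre n := by
    simp only [crossProfile, derivative_sum, Finset.mul_sum]
    rw [← Finset.sum_sub_distrib]
    refine Finset.sum_congr rfl fun n hn => ?_
    have h1 : (n : ℝ) ≠ 0 := by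
      have := (Finset.mem_Icc.1 hn).1
      positivity
    have h2 : (n : ℝ) + 1 ≠ 0 := by positivity
    have h3 : C (ψ n * (2 * n + 1)) =
        C (ψ n * ((2 * n + 1) / (n * (n + 1)))) * ((n : ℝ[X]) * ((n : ℝ[X]) + 1)) := by
      have : (n : ℝ[X]) * ((n : ℝ[X]) + 1) = C ((n : ℝ) * (n + 1)) := by simp
      rw [this, ← C_mul]
      congr 1
      field_simp
    rw [derivative_C_mul, h3]
    linear_combination C (ψ n * ((2 * n + 1) / (n * (n + 1)))) * legendre_ode n
  rw [h, alongProfile]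
  ring

theorem integral_normalProfile_sq (L : ℕ) (ψ : ℕ → ℝ) :
    integralUnit (normalProfile L ψ ^ 2) = ∑ n ∈ Finset.Icc 0 L, 2 * (2 * n + 1) * ψ n ^ 2 := by
  rw [normalProfile, integral_sum_legendre_sq]
  refine Finset.sum_congr rfl fun n _ => ?_
  have : (0 : ℝ) < 2 * n + 1 := by positivity
  field_simp

theorem profileSq_eval_nonneg (L : ℕ) (ψ : ℕ → ℝ) (t : ℝ) : 0 ≤ (profileSq L ψ).eval t := by
  simp only [profileSq, eval_add, eval_pow]
  positivity

/-! ### Norm bounds over the whole interval -/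

theorem sum_range_odd (L : ℕ) : ∑ n ∈ Finset.range L, (2 * (n : ℝ) + 1) = (L : ℝ) ^ 2 := by
  induction L with
  | zero => simp
  | succ n ih => rw [Finset.sum_range_succ, ih]; push_cast; ring

theorem sum_Icc_zero_odd (L : ℕ) :
    ∑ n ∈ Finset.Icc 0 L, (2 * (n : ℝ) + 1) = ((L : ℝ) + 1) ^ 2 := by
  rw [← Nat.range_succ_eq_Icc_zero, sum_range_odd]
  push_cast
  ring

theorem integral_sum_legendre_sq_le (L k : ℕ) {ψ : ℕ → ℝ} {m : ℝ}
    (hψ : ∀ n ≤ L, |ψ n| ≤ m) :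
    integralUnit ((∑ n ∈ Finset.Icc k L, C (ψ n * (2 * n + 1)) * legendre n) ^ 2)
      ≤ 2 * m ^ 2 * ((L : ℝ) + 1) ^ 2 := by
  rw [integral_sum_legendre_sq, ← sum_Icc_zero_odd, Finset.mul_sum]
  calc _ ≤ ∑ n ∈ Finset.Icc 0 L, (ψ n * (2 * n + 1)) ^ 2 * (2 / (2 * n + 1)) := by
        refine Finset.sum_le_sum_of_subset_of_nonneg
          (Finset.Icc_subset_Icc (Nat.zero_le _) le_rfl) fun n _ _ => by positivity
    _ ≤ _ := by
        refine Finset.sum_le_sum fun n hn => ?_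
        have h1 : ψ n ^ 2 ≤ m ^ 2 := sq_le_sq' (abs_le.1 (hψ n (Finset.mem_Icc.1 hn).2)).1
          (abs_le.1 (hψ n (Finset.mem_Icc.1 hn).2)).2
        have h2 : (0 : ℝ) < 2 * n + 1 := by positivity
        have h3 : (ψ n * (2 * n + 1)) ^ 2 * (2 / (2 * n + 1)) = 2 * ψ n ^ 2 * (2 * n + 1) := by
          field_simp
        rw [h3]
        gcongr

/-- The `P_n'` are not orthogonal on `[-1, 1]`, so Cauchy–Schwarz over the `L` terms replaces
Parseval. The extra factor `L` is affordable because each term has bounded squared norm. -/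
theorem integral_crossProfile_sq_le (L : ℕ) {ψ : ℕ → ℝ} {m : ℝ}
    (hψ : ∀ n ≤ L, |ψ n| ≤ m) :
    integralUnit (crossProfile L ψ ^ 2) ≤ 5 * m ^ 2 * (L : ℝ) ^ 2 := by
  have h1 : integralUnit (crossProfile L ψ ^ 2) ≤ integralUnit (C (L : ℝ) * ∑ n ∈ Finset.Icc 1 L,
      (C ((ψ n * ((2 * n + 1) / (n * (n + 1)))) ^ 2) * derivative (legendre n) ^ 2)) := by
    refine integral_mono fun t _ => ?_
    have := sq_sum_le_card_mul_sum_sq (s := Finset.Icc 1 L)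
      (f := fun n => (C (ψ n * ((2 * n + 1) / (n * (n + 1)))) * derivative (legendre n)).eval t)
    simp only [crossProfile, eval_pow, eval_finsetSum, eval_mul, eval_C, mul_pow] at this ⊢
    simpa using this
  refine h1.trans ?_
  rw [integral_C_mul, integral_sum]
  have h2 : ∑ n ∈ Finset.Icc 1 L, integralUnit
      (C ((ψ n * ((2 * n + 1) / (n * (n + 1)))) ^ 2) * derivative (legendre n) ^ 2)
      ≤ ∑ n ∈ Finset.Icc 1 L, 5 * m ^ 2 := by
    refine Finset.sum_le_sum fun n hn => ?_
    rw [integral_C_mul, integral_derivative_legendre_sq]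
    have hn1 : (1 : ℝ) ≤ n := by exact_mod_cast (Finset.mem_Icc.1 hn).1
    have h1 : ψ n ^ 2 ≤ m ^ 2 := sq_le_sq' (abs_le.1 (hψ n (Finset.mem_Icc.1 hn).2)).1
          (abs_le.1 (hψ n (Finset.mem_Icc.1 hn).2)).2
    have h3 : (ψ n * ((2 * n + 1) / (n * (n + 1)))) ^ 2 * (n * (n + 1)) =
        ((2 * n + 1) ^ 2 / (n * (n + 1))) * ψ n ^ 2 := by
      field_simp
    -- The quotient equals `4 + 1/(n(n+1))`.
    have h4 : (2 * (n : ℝ) + 1) ^ 2 / (n * (n + 1)) ≤ 5 := by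
      rw [div_le_iff₀ (by positivity)]
      nlinarith
    rw [h3]
    gcongr
  calc (L : ℝ) * _ ≤ L * ∑ n ∈ Finset.Icc 1 L, 5 * m ^ 2 := by gcongr
    _ = _ := by simp; ring

/-- The squared norm of a kernel over the whole sphere is quadratic in the degree. -/
theorem integral_profileSq_le (L : ℕ) {ψ : ℕ → ℝ} {m : ℝ} (hψ : ∀ n ≤ L, |ψ n| ≤ m) :
    integralUnit (profileSq L ψ) ≤ 21 * m ^ 2 * ((L : ℝ) + 1) ^ 2 := by
  have h1 := integral_sum_legendre_sq_le L 0 hψ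
  have h2 := integral_sum_legendre_sq_le L 1 hψ
  have h3 := integral_crossProfile_sq_le L hψ
  set Q : ℝ[X] := ∑ n ∈ Finset.Icc 1 L, C (ψ n * (2 * n + 1)) * legendre n with hQ
  have h4 : integralUnit (alongProfile L ψ ^ 2) ≤
      integralUnit (C 2 * (Q ^ 2 + crossProfile L ψ ^ 2)) := by
    refine integral_mono fun t ht => ?_
    simp only [alongProfile, eval_mul, eval_add, eval_sub, eval_pow, eval_C, eval_X]
    rw [← hQ]
    generalize Q.eval t = x
    generalize (crossProfile L ψ).eval t = y
    have h5 : t ^ 2 ≤ 1 := by nlinarith [ht.1, ht.2]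
    nlinarith [sq_nonneg (x + t * y), mul_le_mul_of_nonneg_right h5 (sq_nonneg y)]
  rw [integral_C_mul, integral_add] at h4
  rw [profileSq, integral_add, integral_add, normalProfile]
  -- The normal, cross and along parts contribute `2 + 5 + 2(2 + 5) = 21`.
  have h6 : 5 * m ^ 2 * (L : ℝ) ^ 2 ≤ 5 * m ^ 2 * ((L : ℝ) + 1) ^ 2 := by
    gcongr
    linarith
  linarith

/-! ### Localization of the sharp bandpass kernel -/

theorem integral_Icc_le_of_one_sub_X_mul {ρ : ℝ} (hρ : ρ ∈ Set.Ioo (0 : ℝ) 2) {p q : ℝ[X]}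
    (h : (1 - X) * p = q) :
    ∫ t in (-1 : ℝ)..(1 - ρ), (p ^ 2).eval t ≤ (1 / ρ ^ 2) * integralUnit (q ^ 2) := by
  have hρ0 := hρ.1
  have hρ2 := hρ.2
  have h1 : ∫ t in (-1 : ℝ)..(1 - ρ), (p ^ 2).eval t ≤
      ∫ t in (-1 : ℝ)..(1 - ρ), (C (1 / ρ ^ 2) * q ^ 2).eval t := by
    refine intervalIntegral.integral_mono_on (by linarith) (intervalIntegrable_eval _ _ _)
      (intervalIntegrable_eval _ _ _) fun t ht => ?_
    simp only [← h, eval_mul, eval_pow, eval_sub, eval_C, eval_X, eval_one]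
    -- Away from the pole, dividing by `1 - t` costs at most `1/ρ`; afterwards the interval may be
    -- enlarged to `[-1, 1]`.
    have h2 : ρ ^ 2 ≤ (1 - t) ^ 2 := by
      have := ht.2
      gcongr
      linarith
    rw [one_div, ← div_eq_inv_mul, le_div_iff₀ (by positivity), mul_pow, mul_comm]
    gcongr
  refine h1.trans ?_
  rw [← integral_C_mul]
  refine intervalIntegral.integral_mono_interval le_rfl (by linarith) (by linarith)
    (Filter.Eventually.of_forall fun t => ?_) (intervalIntegrable_eval _ _ _)
  simp only [eval_mul, eval_pow, eval_C, Pi.zero_apply]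
  positivity

theorem integral_sub_sq_le (p q : ℝ[X]) :
    integralUnit ((p - q) ^ 2) ≤ 2 * (integralUnit (p ^ 2) + integralUnit (q ^ 2)) := by
  rw [← integral_add, ← integral_C_mul]
  refine integral_mono fun t _ => ?_
  simp only [eval_mul, eval_add, eval_sub, eval_pow, eval_C]
  nlinarith [sq_nonneg (p.eval t + q.eval t)]

/-- The symbols of the sharp bandpass filter with degrees in `(N, ∞)`. -/
noncomputable def sharpSymbol (N n : ℕ) : ℝ := if N < n then 1 else 0

theorem sum_Icc_sharpSymbol (N L : ℕ) (f : ℕ → ℝ[X]) (k : ℕ) (hk : k ≤ 1) :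
    ∑ n ∈ Finset.Icc k L, C (sharpSymbol N n) * f n =
      ∑ n ∈ Finset.Icc (N + 1) L, f n := by
  symm
  have hs : Finset.Icc (N + 1) L ⊆ Finset.Icc k L := Finset.Icc_subset_Icc (by omega) le_rfl
  rw [← Finset.sum_subset_zero_on_sdiff hs (f := f)
    (g := fun n => C (sharpSymbol N n) * f n)]
  · intro n hn
    simp only [Finset.mem_sdiff, Finset.mem_Icc] at hn
    rw [sharpSymbol, if_neg (by omega)]
    simp
  · intro n hn
    rw [sharpSymbol, if_pos (by have := (Finset.mem_Icc.1 hn).1; omega)]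
    simp

/-- The normal profile is a difference of two Christoffel–Darboux sums at the point `1`, so only the
two ends of the band survive. -/
theorem one_sub_X_mul_normalProfile_sharp {N L : ℕ} (h : N ≤ L) :
    (1 - X) * normalProfile L (sharpSymbol N) =
      ((L : ℝ[X]) + 1) * (legendre L - legendre (L + 1))
        - ((N : ℝ[X]) + 1) * (legendre N - legendre (N + 1)) := by
  rw [← one_sub_X_mul_sum_legendre, ← one_sub_X_mul_sum_legendre, ← mul_sub]
  congr 1
  have h1 : normalProfile L (sharpSymbol N) =
      ∑ n ∈ Finset.Icc 0 L, C (sharpSymbol N n) * ((2 * (n : ℝ[X]) + 1) * legendre n) := by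
    refine Finset.sum_congr rfl fun n _ => ?_
    rw [C_mul, mul_assoc]
    simp [map_ofNat C 2]
  rw [h1, sum_Icc_sharpSymbol N L _ 0 (by omega), eq_sub_iff_add_eq, add_comm]
  exact Finset.sum_range_add_sum_Ico _ (by omega : N + 1 ≤ L + 1)

/-- The polynomial `(P_n + P_{n+1}) / (1 + t)`. -/
noncomputable def antipodalQuotient (n : ℕ) : ℝ[X] :=
  ∑ j ∈ Finset.range (n + 1), C ((-1 : ℝ) ^ (n + j) * (2 * j + 1) / (n + 1)) * legendre j

theorem one_add_X_mul_antipodalQuotient (n : ℕ) :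
    (1 + X) * antipodalQuotient n = legendre n + legendre (n + 1) := by
  have h0 := natCast_add_ne_zero n 0
  apply mul_left_cancel₀ h0
  have := one_add_X_mul_sum_legendre n
  push_cast
  rw [← this, ← mul_assoc, mul_comm _ (1 + X), mul_assoc, antipodalQuotient,
    Finset.mul_sum]
  congr 1
  refine Finset.sum_congr rfl fun j _ => ?_
  have h1 : ((n : ℝ[X]) + 1) = C ((n : ℝ) + 1) := by simp
  have h2 : (2 * (j : ℝ[X]) + 1) = C (2 * (j : ℝ) + 1) := by simp [map_ofNat C 2]
  have h3 : ((-1 : ℝ[X]) ^ (n + j)) = C ((-1 : ℝ) ^ (n + j)) := by simp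
  rw [h1, h2, h3, ← mul_assoc, ← mul_assoc, ← C_mul, ← C_mul]
  congr 2
  field_simp

/-- By Parseval this is `2/(n+1)²` times a sum of odd numbers. The point is that dividing by `1 + t`
keeps the norm bounded uniformly in `n`. -/
theorem integral_antipodalQuotient_sq (n : ℕ) : integralUnit (antipodalQuotient n ^ 2) = 2 := by
  rw [antipodalQuotient, integral_sum_legendre_sq]
  have : ∀ j ∈ Finset.range (n + 1), ((-1 : ℝ) ^ (n + j) * (2 * j + 1) / (n + 1)) ^ 2 *
      (2 / (2 * j + 1)) = 2 / (n + 1 : ℝ) ^ 2 * (2 * j + 1) := by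
    intro j _
    rw [div_pow, mul_pow, ← pow_mul, mul_comm (n + j) 2, pow_mul]
    have : (0 : ℝ) < 2 * j + 1 := by positivity
    field_simp
    simp
  rw [Finset.sum_congr rfl this, ← Finset.mul_sum, sum_range_odd]
  push_cast
  field_simp

/-- Since `(2n+1)/(n(n+1)) (1 - t²) P_n' = P_{n-1} - P_{n+1}`, the sum times `1 - t²` telescopes to
`P_N + P_{N+1} - P_L - P_{L+1}`. The factor `1 + t` must be removed exactly, because it vanishes at
the end `-1` of the interval of interest. -/
theorem one_sub_X_mul_crossProfile_sharp {N L : ℕ} (h : N ≤ L) :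
    (1 - X) * crossProfile L (sharpSymbol N) = antipodalQuotient N - antipodalQuotient L := by
  have h0 : (1 + X : ℝ[X]) ≠ 0 := by
    intro h
    have := congrArg (eval 1) h
    norm_num at this
  apply mul_left_cancel₀ h0
  rw [mul_sub, one_add_X_mul_antipodalQuotient, one_add_X_mul_antipodalQuotient]
  have h1 : crossProfile L (sharpSymbol N) = ∑ n ∈ Finset.Icc 1 L, C (sharpSymbol N n) *
      (C ((2 * n + 1) / (n * (n + 1)) : ℝ) * derivative (legendre n)) := by
    refine Finset.sum_congr rfl fun n _ => ?_
    rw [C_mul, mul_assoc]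
  rw [h1, sum_Icc_sharpSymbol N L _ 1 le_rfl]
  clear h1
  induction L, h using Nat.le_induction with
  | base => simp
  | succ L hL ih =>
    rw [Finset.sum_Icc_succ_top (by omega), mul_add, mul_add, ih]
    have h2 : (1 + X) * ((1 - X) * (C ((2 * ((L + 1 : ℕ) : ℝ) + 1) /
        (((L + 1 : ℕ) : ℝ) * (((L + 1 : ℕ) : ℝ) + 1))) * derivative (legendre (L + 1)))) =
        legendre L - legendre (L + 2) := by
      have h3 := one_sub_sq_mul_derivative_legendre' L
      apply mul_left_cancel₀ (mul_ne_zero (natCast_add_ne_zero L 0) (natCast_add_ne_zero L 1))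
      have h4 : ((L : ℝ[X]) + (0 + 1 : ℕ)) * ((L : ℝ[X]) + (1 + 1 : ℕ)) *
          C ((2 * ((L + 1 : ℕ) : ℝ) + 1) / (((L + 1 : ℕ) : ℝ) * (((L + 1 : ℕ) : ℝ) + 1))) =
          2 * (L : ℝ[X]) + 3 := by
        have e1 : ((L : ℝ[X]) + (0 + 1 : ℕ)) * ((L : ℝ[X]) + (1 + 1 : ℕ)) =
          C (((L : ℝ) + 1) * (L + 2)) := by simp [map_ofNat C 2]
        have e2 : 2 * (L : ℝ[X]) + 3 = C (2 * (L : ℝ) + 3) := by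
          simp [map_ofNat C 2, map_ofNat C 3]
        rw [e1, e2, ← C_mul]
        congr 1
        push_cast
        have : (L : ℝ) + 1 + 1 ≠ 0 := by positivity
        field_simp
        ring
      push_cast at h4 ⊢
      linear_combination (1 - X ^ 2) * derivative (legendre (L + 1)) * h4 + h3
    rw [h2]
    ring

/-- The sharp bandpass kernel is localized: away from the pole its squared norm is only linear
in the degree. -/
theorem integral_profileSq_sharp_le {ρ : ℝ} (hρ : ρ ∈ Set.Ioo (0 : ℝ) 2) {N L : ℕ} (h : N ≤ L) :
    ∫ t in (-1 : ℝ)..(1 - ρ), (profileSq L (sharpSymbol N)).eval t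
      ≤ 120 / ρ ^ 2 * ((L : ℝ) + 1) := by
  have hρ0 := hρ.1
  have hρ2 := hρ.2
  have hA := integral_Icc_le_of_one_sub_X_mul hρ (one_sub_X_mul_normalProfile_sharp h)
  have hG := integral_Icc_le_of_one_sub_X_mul hρ (one_sub_X_mul_crossProfile_sharp h)
  have hB : ∫ t in (-1 : ℝ)..(1 - ρ), (profileSq L (sharpSymbol N)).eval t ≤
      ∫ t in (-1 : ℝ)..(1 - ρ), (3 * ((normalProfile L (sharpSymbol N) ^ 2).eval t +
        (crossProfile L (sharpSymbol N) ^ 2).eval t)) := by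
    refine intervalIntegral.integral_mono_on (by linarith) (intervalIntegrable_eval _ _ _)
      (((intervalIntegrable_eval _ _ _).add (intervalIntegrable_eval _ _ _)).const_mul _)
      fun t ht => ?_
    -- The band contains no degree `0`, so the sum from `1` in the along profile is the full normal
    -- profile. With `(x - ty)² ≤ 2x² + 2y²` this yields the factor `3`.
    have h1 : alongProfile L (sharpSymbol N) =
        normalProfile L (sharpSymbol N) - X * crossProfile L (sharpSymbol N) := by
      have h2 : ∑ n ∈ Finset.Icc 1 L, C (sharpSymbol N n * (2 * n + 1)) * legendre n =
          normalProfile L (sharpSymbol N) := by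
        simp only [normalProfile, C_mul, mul_assoc]
        rw [sum_Icc_sharpSymbol N L _ 1 le_rfl, sum_Icc_sharpSymbol N L _ 0 zero_le_one]
      rw [alongProfile, h2]
    simp only [profileSq, h1, eval_mul, eval_add, eval_sub, eval_pow, eval_X]
    generalize (normalProfile L (sharpSymbol N)).eval t = x
    generalize (crossProfile L (sharpSymbol N)).eval t = y
    have h5 : t ^ 2 ≤ 1 := by nlinarith [ht.1, ht.2]
    nlinarith [sq_nonneg (x + t * y), mul_le_mul_of_nonneg_right h5 (sq_nonneg y)]
  rw [intervalIntegral.integral_const_mul, intervalIntegral.integral_add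
    (intervalIntegrable_eval _ _ _) (intervalIntegrable_eval _ _ _)] at hB
  have hE := integral_sub_sq_le (antipodalQuotient N) (antipodalQuotient L)
  rw [integral_antipodalQuotient_sq, integral_antipodalQuotient_sq] at hE
  have hq : ∀ n : ℕ, integralUnit ((((n : ℝ[X]) + 1) * (legendre n - legendre (n + 1))) ^ 2)
      ≤ 8 * ((n : ℝ) + 1) := by
    intro n
    have e : (((n : ℝ[X]) + 1) * (legendre n - legendre (n + 1))) ^ 2 =
        C (((n : ℝ) + 1) ^ 2) * (legendre n - legendre (n + 1)) ^ 2 := by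
      simp; ring
    rw [e, integral_C_mul]
    have h1 := integral_sub_sq_le (legendre n) (legendre (n + 1))
    rw [integral_legendre_sq, integral_legendre_sq] at h1
    have h2 : (2 : ℝ) / (2 * n + 1) ≤ 2 / (n + 1) := by
      gcongr
      linarith [(Nat.cast_nonneg n : (0 : ℝ) ≤ n)]
    have h3 : (2 : ℝ) / (2 * (n + 1 : ℕ) + 1) ≤ 2 / (n + 1) := by
      push_cast
      gcongr
      linarith [(Nat.cast_nonneg n : (0 : ℝ) ≤ n)]
    calc _ ≤ ((n : ℝ) + 1) ^ 2 * (2 * (2 / (n + 1) + 2 / (n + 1))) := by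
          gcongr
          linarith
      _ = _ := by field_simp; ring
  have hA' := integral_sub_sq_le (((L : ℝ[X]) + 1) * (legendre L - legendre (L + 1)))
    (((N : ℝ[X]) + 1) * (legendre N - legendre (N + 1)))
  have hN : (N : ℝ) ≤ L := by exact_mod_cast h
  have hL0 : (0 : ℝ) ≤ L := Nat.cast_nonneg L
  calc _ ≤ _ := hB
    -- Here `32 = 2(8 + 8)` from `hq` at `L` and at `N ≤ L`, and `8 = 2(2 + 2)` from the antipodal
    -- quotients.
    _ ≤ 3 * (1 / ρ ^ 2 * (32 * ((L : ℝ) + 1)) + 1 / ρ ^ 2 * 8) := by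
        gcongr
        · refine hA.trans ?_
          gcongr
          linarith [hq L, hq N]
        · refine hG.trans ?_
          gcongr
          linarith
    _ ≤ 3 * (1 / ρ ^ 2 * (32 * ((L : ℝ) + 1)) + 1 / ρ ^ 2 * (8 * ((L : ℝ) + 1))) := by
        gcongr
        linarith
    _ = _ := by ring

theorem profileSq_eval_add_le (L : ℕ) (ψ₁ ψ₂ : ℕ → ℝ) (t : ℝ) :
    (profileSq L (fun n => ψ₁ n + ψ₂ n)).eval t ≤
      2 * (profileSq L ψ₁).eval t + 2 * (profileSq L ψ₂).eval t := by
  have h1 : normalProfile L (fun n => ψ₁ n + ψ₂ n) =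
      normalProfile L ψ₁ + normalProfile L ψ₂ := by
    simp only [normalProfile, add_mul, C_add, Finset.sum_add_distrib]
  have h2 : crossProfile L (fun n => ψ₁ n + ψ₂ n) =
      crossProfile L ψ₁ + crossProfile L ψ₂ := by
    simp only [crossProfile, add_mul, C_add, Finset.sum_add_distrib]
  have h3 : alongProfile L (fun n => ψ₁ n + ψ₂ n) =
      alongProfile L ψ₁ + alongProfile L ψ₂ := by
    rw [alongProfile, h2]
    simp only [alongProfile, add_mul, C_add, Finset.sum_add_distrib]
    ring
  simp only [profileSq, h1, h2, h3, eval_add, eval_pow]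
  nlinarith [sq_nonneg ((normalProfile L ψ₁).eval t - (normalProfile L ψ₂).eval t),
    sq_nonneg ((crossProfile L ψ₁).eval t - (crossProfile L ψ₂).eval t),
    sq_nonneg ((alongProfile L ψ₁).eval t - (alongProfile L ψ₂).eval t)]

end LegendrePolynomial

/-! ### Harmonic homogeneous polynomials in three variables -/

namespace LegendrePolynomial

open Polynomial

/-- The origin is a regular singular point with double indicial root `0`: the equation forces the
linear coefficient to vanish and gives `(k+2)² h_{k+2}` as a multiple of `h_k`, so the constant
coefficient determines everything. -/
theorem eq_zero_of_zonal_ode {h : ℝ[X]} (n : ℕ) (h0 : h.coeff 0 = 0)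
    (hode : X * (derivative (derivative h) + C ((n : ℝ) * (n - 1)) * h
      - C (2 * ((n : ℝ) - 1)) * (X * derivative h) + X * (X * derivative (derivative h)))
      + derivative h = 0) : h = 0 := by
  have key : ∀ k, h.coeff k = 0 := by
    intro k
    induction k using Nat.strong_induction_on with
    | _ k ih =>
      match k, ih with
      | 0, _ => exact h0
      | 1, _ =>
        have := congrArg (fun q : ℝ[X] => q.coeff 0) hode
        simpa [coeff_derivative] using this
      | k + 2, ih =>
        have := congrArg (fun q : ℝ[X] => q.coeff (k + 1)) hode
        have hk := ih k (by omega)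
        have e1 : (X * derivative h).coeff k = 0 := by
          cases k with
          | zero => simp
          | succ k => simp [coeff_derivative, hk]
        have e2 : (X * (X * derivative (derivative h))).coeff k = 0 := by
          match k, hk with
          | 0, _ => simp
          | 1, _ => simp
          | k + 2, hk => simp [coeff_derivative, hk]
        simp only [coeff_add, coeff_X_mul, coeff_sub, coeff_C_mul, e1, e2, hk, coeff_derivative,
          coeff_zero, mul_zero, add_zero, sub_zero] at this
        push_cast at this
        have e3 : ((k : ℝ) + 2) ^ 2 * h.coeff (k + 2) = 0 := by linear_combination this
        have e4 : ((k : ℝ) + 2) ^ 2 ≠ 0 := by positivity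
        exact (mul_eq_zero.1 e3).resolve_left e4
  ext k
  simp [key]

end LegendrePolynomial

namespace MvPolynomial

/-! ### Polynomial calculus and the dimension of the space of harmonics -/

theorem pderiv_comm {σ R : Type*} [CommSemiring R] (i j : σ) (p : MvPolynomial σ R) :
    pderiv i (pderiv j p) = pderiv j (pderiv i p) := by
  classical
  ext m
  simp only [coeff_pderiv, Finsupp.add_apply, Finsupp.single_apply]
  rw [add_right_comm]
  by_cases h : i = j
  · subst h; ring
  · rw [if_neg h, if_neg (Ne.symm h)]
    ring_nf

theorem hasDerivAt_eval {σ : Type*} [Fintype σ] (p : MvPolynomial σ ℝ) {c : ℝ → σ → ℝ}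
    {c' : σ → ℝ} {s : ℝ} (hc : ∀ i, HasDerivAt (fun s => c s i) (c' i) s) :
    HasDerivAt (fun s => eval (c s) p) (∑ i, eval (c s) (pderiv i p) * c' i) s := by
  classical
  induction p using MvPolynomial.induction_on with
  | C a => simpa using hasDerivAt_const s a
  | add p q hp hq =>
    simp only [map_add, add_mul, Finset.sum_add_distrib]
    exact hp.add hq
  | mul_X p j hp =>
    simp only [map_mul, eval_X, pderiv_mul, map_add, pderiv_X, Pi.single_apply]
    refine (hp.fun_mul (hc j)).congr_deriv ?_
    rw [Finset.sum_mul]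
    have h1 : eval (c s) p * c' j =
        ∑ i, eval (c s) p * (if i = j then 1 else 0) * c' i := by
      simp
    rw [h1, ← Finset.sum_add_distrib]
    refine Finset.sum_congr rfl fun i _ => ?_
    by_cases h : i = j
    · subst h; simp; ring
    · simp [h, Ne.symm h, mul_right_comm]

theorem IsHomogeneous.eval_mul {σ : Type*} {p : MvPolynomial σ ℝ} {n : ℕ}
    (hp : p.IsHomogeneous n) (a : ℝ) (x : σ → ℝ) :
    eval (fun i => a * x i) p = a ^ n * eval x p := by
  rw [eval_eq, eval_eq, Finset.mul_sum]
  refine Finset.sum_congr rfl fun d hd => ?_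
  have h : n = ∑ i ∈ d.support, d i := hp.degree_eq_sum_deg_support hd
  simp only [mul_pow, Finset.prod_mul_distrib, Finset.prod_pow_eq_pow_sum]
  rw [h]
  ring

/-- The Laplacian on polynomials. -/
noncomputable def laplace : MvPolynomial (Fin 3) ℝ →ₗ[ℝ] MvPolynomial (Fin 3) ℝ :=
  ∑ i, (pderiv i).toLinearMap ∘ₗ (pderiv i).toLinearMap

theorem laplace_apply (p : MvPolynomial (Fin 3) ℝ) :
    laplace p = ∑ i, pderiv i (pderiv i p) := by
  simp [laplace]

/-- Harmonic homogeneous polynomials of degree `n`. -/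
noncomputable def harmonicSubmodule (n : ℕ) : Submodule ℝ (MvPolynomial (Fin 3) ℝ) :=
  homogeneousSubmodule (Fin 3) ℝ n ⊓ LinearMap.ker laplace

theorem mem_harmonicSubmodule {n : ℕ} {p : MvPolynomial (Fin 3) ℝ} :
    p ∈ harmonicSubmodule n ↔ p.IsHomogeneous n ∧ laplace p = 0 := by
  simp [harmonicSubmodule]

/-- The coefficients of a harmonic polynomial that determine all others. -/
noncomputable def leadingCoeffs (n : ℕ) :
    harmonicSubmodule n →ₗ[ℝ] (Fin (n + 1) ⊕ Fin n → ℝ) where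
  toFun p := Sum.elim
    (fun i => coeff (Finsupp.equivFunOnFinite.symm ![(i : ℕ), n - i, 0]) p.1)
    (fun i => coeff (Finsupp.equivFunOnFinite.symm ![(i : ℕ), n - 1 - i, 1]) p.1)
  map_add' p q := by ext (i | i) <;> simp
  map_smul' a p := by ext (i | i) <;> simp

/-- Laplace's equation expresses each coefficient of `z`-degree `k + 2` through coefficients of
`z`-degree `k`. Those of `z`-degree `0` and `1`, which number `(n + 1) + n`, therefore determine the
polynomial. -/
theorem leadingCoeffs_injective (n : ℕ) : Function.Injective (leadingCoeffs n) := by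
  rw [← LinearMap.ker_eq_bot, LinearMap.ker_eq_bot']
  rintro ⟨p, hp⟩ h0
  obtain ⟨hhom, hlap⟩ := mem_harmonicSubmodule.1 hp
  ext1
  have key : ∀ k : ℕ, ∀ d : Fin 3 →₀ ℕ, d 2 = k → coeff d p = 0 := by
    intro k
    induction k using Nat.strong_induction_on with
    | _ k ih =>
      intro d hd
      by_cases hdeg : d.degree = n
      swap
      · exact hhom.coeff_eq_zero hdeg
      have hsum : d 0 + d 1 + d 2 = n := by
        rw [← hdeg, Finsupp.degree_eq_sum, Fin.sum_univ_three]
      match k, hd, ih with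
      | 0, hd, _ =>
        have := congrFun h0 (Sum.inl ⟨d 0, by omega⟩)
        simp only [leadingCoeffs, LinearMap.coe_mk, AddHom.coe_mk, Sum.elim_inl] at this
        rw [Pi.zero_apply] at this
        rw [← this]
        congr 1
        ext i
        fin_cases i <;> simp <;> omega
      | 1, hd, _ =>
        have := congrFun h0 (Sum.inr ⟨d 0, by omega⟩)
        simp only [leadingCoeffs, LinearMap.coe_mk, AddHom.coe_mk, Sum.elim_inr] at this
        rw [Pi.zero_apply] at this
        rw [← this]
        congr 1
        ext i
        fin_cases i <;> simp <;> omega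
      | k + 2, hd, ih =>
        set e : Fin 3 →₀ ℕ := d - Finsupp.single 2 2 with he
        have hde : d = e + Finsupp.single 2 1 + Finsupp.single 2 1 := by
          ext i
          fin_cases i <;> simp [he]; omega
        have h1 := congrArg (coeff e) hlap
        have he2 : e 2 = k := by simp [he]; omega
        simp only [laplace_apply, Fin.sum_univ_three, coeff_add, coeff_pderiv, coeff_zero] at h1
        rw [← hde, ih k (by omega) _ (by simp [he2]), ih k (by omega) _ (by simp [he2])] at h1
        simp only [zero_mul, zero_add] at h1
        have h2 : ((e 2 : ℕ) : ℝ) + 1 + 1 ≠ 0 := by positivity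
        have h3 : ((e 2 : ℕ) : ℝ) + 1 ≠ 0 := by positivity
        simpa [h2, h3] using h1
  ext d
  simpa using key _ d rfl

instance (n : ℕ) : FiniteDimensional ℝ (harmonicSubmodule n) :=
  FiniteDimensional.of_injective _ (leadingCoeffs_injective n)

/-- Only the upper bound is needed: the given orthonormal family supplies the lower one. -/
theorem finrank_harmonicSubmodule_le (n : ℕ) :
    Module.finrank ℝ (harmonicSubmodule n) ≤ 2 * n + 1 := by
  refine (LinearMap.finrank_le_finrank_of_injective (leadingCoeffs_injective n)).trans ?_
  simp
  omega

/-! ### Orthogonal changes of variables -/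

/-- Linear change of variables. -/
noncomputable def linearSubst (M : Matrix (Fin 3) (Fin 3) ℝ) :
    MvPolynomial (Fin 3) ℝ →ₐ[ℝ] MvPolynomial (Fin 3) ℝ :=
  aeval fun i => ∑ j, C (M i j) * X j

theorem eval_linearSubst (M : Matrix (Fin 3) (Fin 3) ℝ) (p : MvPolynomial (Fin 3) ℝ)
    (x : Fin 3 → ℝ) : eval x (linearSubst M p) = eval (M.mulVec x) p := by
  induction p using MvPolynomial.induction_on with
  | C a => simp [linearSubst]
  | add p q hp hq => rw [map_add, map_add, hp, hq, map_add]
  | mul_X p j hp =>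
    rw [map_mul, map_mul, hp, map_mul, eval_X]
    congr 1
    simp [linearSubst, Matrix.mulVec, dotProduct]

theorem pderiv_linearSubst (M : Matrix (Fin 3) (Fin 3) ℝ) (p : MvPolynomial (Fin 3) ℝ)
    (j : Fin 3) :
    pderiv j (linearSubst M p) = ∑ i, C (M i j) * linearSubst M (pderiv i p) := by
  induction p using MvPolynomial.induction_on with
  | C a => simp [linearSubst]
  | add p q hp hq => simp only [map_add, hp, hq, mul_add, Finset.sum_add_distrib]
  | mul_X p k hp =>
    have h1 : pderiv j (linearSubst M (X k)) = C (M k j) := by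
      simp [linearSubst, pderiv_X, Pi.single_apply]
    rw [map_mul, pderiv_mul, hp, h1]
    simp only [pderiv_mul, map_add, map_mul, pderiv_X, Pi.single_apply]
    simp only [mul_add, Finset.sum_add_distrib, Finset.sum_mul, mul_assoc]
    congr 1
    rw [Finset.sum_eq_single k]
    · simp; ring
    · intro i _ hi; simp [hi.symm]
    · simp

theorem laplace_linearSubst {M : Matrix (Fin 3) (Fin 3) ℝ} (hM : M * M.transpose = 1)
    (p : MvPolynomial (Fin 3) ℝ) : laplace (linearSubst M p) = linearSubst M (laplace p) := by
  have hM' : ∀ i k, ∑ j, M i j * M k j = if i = k then 1 else 0 := by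
    intro i k
    have := congrFun (congrFun hM i) k
    simpa [Matrix.mul_apply, Matrix.one_apply] using this
  simp only [laplace_apply, pderiv_linearSubst, map_sum, pderiv_mul, pderiv_C, zero_mul, zero_add,
    Finset.mul_sum]
  rw [Finset.sum_comm]
  refine Finset.sum_congr rfl fun i _ => ?_
  rw [Finset.sum_comm]
  have : ∀ k : Fin 3, ∑ j, C (M i j) * (C (M k j) * linearSubst M (pderiv k (pderiv i p))) =
      if i = k then linearSubst M (pderiv k (pderiv i p)) else 0 := by
    intro k
    simp only [← mul_assoc, ← C_mul, ← Finset.sum_mul, ← map_sum, hM']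
    split_ifs <;> simp
  simp [this]

theorem linearSubst_mem_harmonicSubmodule {M : Matrix (Fin 3) (Fin 3) ℝ}
    (hM : M * M.transpose = 1) {n : ℕ} {p : MvPolynomial (Fin 3) ℝ}
    (hp : p ∈ harmonicSubmodule n) : linearSubst M p ∈ harmonicSubmodule n := by
  rw [mem_harmonicSubmodule] at hp ⊢
  refine ⟨?_, by rw [laplace_linearSubst hM, hp.2, map_zero]⟩
  have := hp.1.aeval (n := 1) (fun i => ∑ j, C (M i j) * X j : Fin 3 → MvPolynomial (Fin 3) ℝ)
    (fun i => IsHomogeneous.sum _ _ _ fun j _ => isHomogeneous_C_mul_X _ _)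
  simpa [linearSubst] using this

/-! ### Solid zonal harmonics -/

/-- The solid zonal harmonics `|x|ⁿ P_n(x₃ / |x|)`. -/
noncomputable def solidLegendre : ℕ → MvPolynomial (Fin 3) ℝ
  | 0 => 1
  | 1 => X 2
  | n + 2 => C ((n + 2 : ℝ)⁻¹) * (C (2 * n + 3 : ℝ) * X 2 * solidLegendre (n + 1)
      - C (n + 1 : ℝ) * (X 0 ^ 2 + X 1 ^ 2 + X 2 ^ 2) * solidLegendre n)

theorem solidLegendre_zero : solidLegendre 0 = 1 := by rw [solidLegendre]

theorem solidLegendre_one : solidLegendre 1 = X 2 := by rw [solidLegendre]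

theorem solidLegendre_rec (n : ℕ) :
    ((n : MvPolynomial (Fin 3) ℝ) + 2) * solidLegendre (n + 2) =
      (2 * (n : MvPolynomial (Fin 3) ℝ) + 3) * X 2 * solidLegendre (n + 1)
        - ((n : MvPolynomial (Fin 3) ℝ) + 1) * (X 0 ^ 2 + X 1 ^ 2 + X 2 ^ 2)
          * solidLegendre n := by
  rw [solidLegendre, ← mul_assoc]
  have h : ((n : MvPolynomial (Fin 3) ℝ) + 2) * C ((n + 2 : ℝ)⁻¹) = 1 := by
    have : ((n : MvPolynomial (Fin 3) ℝ) + 2) = C (n + 2 : ℝ) := by simp [map_ofNat C 2]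
    rw [this, ← C_mul, mul_inv_cancel₀ (by positivity), C_1]
  rw [h]
  simp [map_ofNat C 2, map_ofNat C 3]

theorem natCast_add_ne_zero' (n k : ℕ) :
    ((n : MvPolynomial (Fin 3) ℝ) + (k + 1 : ℕ)) ≠ 0 := by
  exact_mod_cast (Nat.succ_ne_zero (n + k))

theorem isHomogeneous_solidLegendre (n : ℕ) : (solidLegendre n).IsHomogeneous n := by
  induction n using Nat.strong_induction_on with
  | _ n ih =>
    match n, ih with
    | 0, _ => rw [solidLegendre_zero]; exact isHomogeneous_one _ _
    | 1, _ => rw [solidLegendre_one]; exact isHomogeneous_X _ _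
    | n + 2, ih =>
      rw [solidLegendre]
      refine IsHomogeneous.C_mul (IsHomogeneous.sub ?_ ?_) _
      · have := (isHomogeneous_C_mul_X (2 * (n : ℝ) + 3) (2 : Fin 3)).mul (ih (n + 1) (by omega))
        rwa [show 1 + (n + 1) = n + 2 by omega] at this
      · have h2 : (X 0 ^ 2 + X 1 ^ 2 + X 2 ^ 2 : MvPolynomial (Fin 3) ℝ).IsHomogeneous 2 :=
          ((isHomogeneous_X_pow _ _).add (isHomogeneous_X_pow _ _)).add (isHomogeneous_X_pow _ _)
        have := (h2.C_mul (n + 1 : ℝ)).mul (ih n (by omega))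
        rwa [show 2 + n = n + 2 by omega] at this

theorem pderiv_natCast (i : Fin 3) (n : ℕ) :
    pderiv i (n : MvPolynomial (Fin 3) ℝ) = 0 := (pderiv i).map_natCast n

theorem pderiv_two_solidLegendre_rec (n : ℕ) :
    ((n : MvPolynomial (Fin 3) ℝ) + 2) * pderiv 2 (solidLegendre (n + 2)) =
      (2 * (n : MvPolynomial (Fin 3) ℝ) + 3)
          * (solidLegendre (n + 1) + X 2 * pderiv 2 (solidLegendre (n + 1)))
        - ((n : MvPolynomial (Fin 3) ℝ) + 1) * (2 * X 2 * solidLegendre n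
          + (X 0 ^ 2 + X 1 ^ 2 + X 2 ^ 2) * pderiv 2 (solidLegendre n)) := by
  have h := congrArg (pderiv 2) (solidLegendre_rec n)
  have e2 : pderiv (2 : Fin 3) (2 : MvPolynomial (Fin 3) ℝ) = 0 := by
    exact_mod_cast pderiv_natCast 2 2
  have e3 : pderiv (2 : Fin 3) (3 : MvPolynomial (Fin 3) ℝ) = 0 := by
    exact_mod_cast pderiv_natCast 2 3
  have x0 : pderiv (2 : Fin 3) (X 0 : MvPolynomial (Fin 3) ℝ) = 0 := pderiv_X_of_ne (by decide)
  have x1 : pderiv (2 : Fin 3) (X 1 : MvPolynomial (Fin 3) ℝ) = 0 := pderiv_X_of_ne (by decide)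
  simp only [pderiv_mul, map_add, map_sub, pderiv_natCast, e2, e3, pderiv_one, sq, x0, x1,
    pderiv_X_self] at h
  linear_combination h

theorem pderiv_two_solidLegendre (n : ℕ) :
    pderiv 2 (solidLegendre (n + 1)) = ((n : MvPolynomial (Fin 3) ℝ) + 1) * solidLegendre n := by
  induction n using Nat.strong_induction_on with
  | _ n ih =>
    match n, ih with
    | 0, _ => simp [solidLegendre_one, solidLegendre_zero]
    | 1, _ =>
      have h := pderiv_two_solidLegendre_rec 0
      have h0 := natCast_add_ne_zero' 0 1
      simp only [zero_add, solidLegendre_one, solidLegendre_zero, pderiv_X_self, pderiv_one] at h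
      push_cast at h0 h
      apply mul_left_cancel₀ h0
      push_cast
      simp only [zero_add, solidLegendre_one]
      linear_combination h
    | n + 2, ih =>
      have h := pderiv_two_solidLegendre_rec (n + 1)
      have i1 := ih (n + 1) (by omega)
      have i0 := ih n (by omega)
      have r := solidLegendre_rec n
      have h0 := natCast_add_ne_zero' n 2
      apply mul_left_cancel₀ h0
      push_cast at h i1 i0 r ⊢
      linear_combination h + (2 * (n : MvPolynomial (Fin 3) ℝ) + 5) * X 2 * i1
        - ((n : MvPolynomial (Fin 3) ℝ) + 2) * (X 0 ^ 2 + X 1 ^ 2 + X 2 ^ 2) * i0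
        - ((n : MvPolynomial (Fin 3) ℝ) + 2) * r

theorem laplace_C_mul (a : ℝ) (p : MvPolynomial (Fin 3) ℝ) :
    laplace (C a * p) = C a * laplace p := by
  rw [← smul_eq_C_mul, ← smul_eq_C_mul, map_smul]

theorem laplace_X_two_mul (p : MvPolynomial (Fin 3) ℝ) :
    laplace (X 2 * p) = 2 * pderiv 2 p + X 2 * laplace p := by
  have x0 : pderiv (0 : Fin 3) (X 2 : MvPolynomial (Fin 3) ℝ) = 0 := pderiv_X_of_ne (by decide)
  have x1 : pderiv (1 : Fin 3) (X 2 : MvPolynomial (Fin 3) ℝ) = 0 := pderiv_X_of_ne (by decide)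
  simp only [laplace_apply, Fin.sum_univ_three, pderiv_mul, map_add, x0, x1, pderiv_X_self,
    zero_mul, one_mul, zero_add, map_zero, pderiv_one]
  ring

theorem laplace_normSq_mul (p : MvPolynomial (Fin 3) ℝ) :
    laplace ((X 0 ^ 2 + X 1 ^ 2 + X 2 ^ 2) * p) =
      6 * p + 4 * ∑ i, X i * pderiv i p + (X 0 ^ 2 + X 1 ^ 2 + X 2 ^ 2) * laplace p := by
  have x : ∀ i j : Fin 3, i ≠ j → pderiv i (X j : MvPolynomial (Fin 3) ℝ) = 0 :=
    fun i j h => pderiv_X_of_ne h.symm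
  simp only [laplace_apply, Fin.sum_univ_three, pderiv_mul, map_add, pderiv_X_self, sq,
    x 0 1 (by decide), x 0 2 (by decide), x 1 0 (by decide), x 1 2 (by decide),
    x 2 0 (by decide), x 2 1 (by decide), pderiv_one, map_zero,
    zero_mul, one_mul, zero_add, mul_zero, mul_one]
  ring

/-- Write `Z_n` for the solid harmonic. In the recurrence, `Δ(z Z_{n+1}) = 2 ∂_z Z_{n+1} = 2(n+1)
Z_n` and, by Euler, `Δ(|x|² Z_n) = (4n+6) Z_n`; with the factors `2n+3` and `n+1` these cancel. -/
theorem laplace_solidLegendre (n : ℕ) : laplace (solidLegendre n) = 0 := by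
  induction n using Nat.strong_induction_on with
  | _ n ih =>
    match n, ih with
    | 0, _ => simp [solidLegendre_zero, laplace_apply]
    | 1, _ =>
      have := laplace_X_two_mul 1
      rw [mul_one] at this
      rw [solidLegendre_one, this]
      simp [laplace_apply]
    | n + 2, ih =>
      rw [solidLegendre, laplace_C_mul, map_sub, mul_assoc, mul_assoc, laplace_C_mul,
        laplace_C_mul, laplace_X_two_mul, laplace_normSq_mul, ih n (by omega),
        ih (n + 1) (by omega), pderiv_two_solidLegendre,
        (isHomogeneous_solidLegendre n).sum_X_mul_pderiv]
      simp only [map_add, map_mul, map_natCast, map_ofNat C 2, map_ofNat C 3, map_one,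
        nsmul_eq_mul]
      ring

theorem solidLegendre_mem (n : ℕ) : solidLegendre n ∈ harmonicSubmodule n :=
  mem_harmonicSubmodule.2 ⟨isHomogeneous_solidLegendre n, laplace_solidLegendre n⟩

theorem eval_solidLegendre (n : ℕ) {x : Fin 3 → ℝ} (hx : x 0 ^ 2 + x 1 ^ 2 + x 2 ^ 2 = 1) :
    eval x (solidLegendre n) = (LegendrePolynomial.legendre n).eval (x 2) := by
  induction n using Nat.strong_induction_on with
  | _ n ih =>
    match n, ih with
    | 0, _ => simp [solidLegendre_zero, LegendrePolynomial.legendre_zero]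
    | 1, _ => simp [solidLegendre_one, LegendrePolynomial.legendre_one]
    | n + 2, ih =>
      rw [solidLegendre, LegendrePolynomial.legendre]
      simp [ih n (by omega), ih (n + 1) (by omega), hx]

/-! ### Uniqueness of zonal harmonics -/

/-- Restriction of a polynomial to the line through `(0, 0, 1)` in direction `(1, 0, 0)`. -/
noncomputable def restrictLine : MvPolynomial (Fin 3) ℝ →ₐ[ℝ] Polynomial ℝ :=
  aeval ![Polynomial.X, 0, 1]

theorem derivative_restrictLine (p : MvPolynomial (Fin 3) ℝ) :
    Polynomial.derivative (restrictLine p) = restrictLine (pderiv 0 p) := by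
  induction p using MvPolynomial.induction_on with
  | C a => simp [restrictLine]
  | add p q hp hq => simp only [map_add, hp, hq]
  | mul_X p j hp =>
    simp only [map_mul, Polynomial.derivative_mul, pderiv_mul, map_add, hp]
    congr 2
    fin_cases j <;> simp [restrictLine, pderiv_X]

theorem eval_restrictLine (p : MvPolynomial (Fin 3) ℝ) (a : ℝ) :
    (restrictLine p).eval a = eval ![a, 0, 1] p := by
  induction p using MvPolynomial.induction_on with
  | C a => simp [restrictLine]
  | add p q hp hq => simp only [map_add, Polynomial.eval_add, hp, hq]
  | mul_X p j hp =>
    simp only [map_mul, Polynomial.eval_mul, hp]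
    congr 1
    fin_cases j <;> simp [restrictLine]

/-- A zonal harmonic polynomial that vanishes at the pole is zero. -/
theorem eq_zero_of_zonal {n : ℕ} {p : MvPolynomial (Fin 3) ℝ} (hp : p ∈ harmonicSubmodule n)
    (hrot : ∀ x y z s : ℝ, eval ![x * Real.cos s - y * Real.sin s,
      x * Real.sin s + y * Real.cos s, z] p = eval ![x, y, z] p)
    (h0 : eval ![0, 0, 1] p = 0) : p = 0 := by
  obtain ⟨hhom, hlap⟩ := mem_harmonicSubmodule.1 hp
  -- Infinitesimal form of the invariance: differentiate at rotation angle `0`.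
  have hD : X 0 * pderiv 1 p - X 1 * pderiv 0 p = 0 := by
    apply MvPolynomial.funext
    intro x
    have h1 : HasDerivAt (fun s : ℝ => eval ![x 0 * Real.cos s - x 1 * Real.sin s,
        x 0 * Real.sin s + x 1 * Real.cos s, x 2] p)
        (∑ i, eval ![x 0, x 1, x 2] (pderiv i p) * ![-x 1, x 0, 0] i) 0 := by
      have := hasDerivAt_eval p (c := fun s : ℝ => ![x 0 * Real.cos s - x 1 * Real.sin s,
        x 0 * Real.sin s + x 1 * Real.cos s, x 2]) (c' := ![-x 1, x 0, 0]) (s := 0) ?_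
      · simpa using this
      · intro i
        fin_cases i
        · simpa using ((Real.hasDerivAt_cos 0).const_mul (x 0)).fun_sub
            ((Real.hasDerivAt_sin 0).const_mul (x 1))
        · simpa using ((Real.hasDerivAt_sin 0).const_mul (x 0)).fun_add
            ((Real.hasDerivAt_cos 0).const_mul (x 1))
        · simpa using hasDerivAt_const (0 : ℝ) (x 2)
    simp only [hrot] at h1
    have h2 := h1.unique (hasDerivAt_const _ _)
    have hx : ![x 0, x 1, x 2] = x := by ext i; fin_cases i <;> rfl
    rw [hx] at h2
    simp [Fin.sum_univ_three] at h2
    simp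
    linarith
  have x01 : pderiv (0 : Fin 3) (X 1 : MvPolynomial (Fin 3) ℝ) = 0 := pderiv_X_of_ne (by decide)
  have x02 : pderiv (0 : Fin 3) (X 2 : MvPolynomial (Fin 3) ℝ) = 0 := pderiv_X_of_ne (by decide)
  have x10 : pderiv (1 : Fin 3) (X 0 : MvPolynomial (Fin 3) ℝ) = 0 := pderiv_X_of_ne (by decide)
  have x20 : pderiv (2 : Fin 3) (X 0 : MvPolynomial (Fin 3) ℝ) = 0 := pderiv_X_of_ne (by decide)
  have x21 : pderiv (2 : Fin 3) (X 1 : MvPolynomial (Fin 3) ℝ) = 0 := pderiv_X_of_ne (by decide)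
  have rX : restrictLine (X 0) = Polynomial.X := by simp [restrictLine]
  have rY : restrictLine (X 1) = 0 := by simp [restrictLine]
  have rZ : restrictLine (X 2) = 1 := by simp [restrictLine]
  -- On the line `y = 0`, `z = 1` this reads `x p_yy = p_x`. Euler's identity and its `x`- and
  -- `z`-derivatives eliminate `p_z`, `p_xz` and `p_zz`, so Laplace's equation becomes an ordinary
  -- one in `x`.
  have hD1 := congrArg restrictLine (congrArg (pderiv 1) hD)
  have hE := hhom.sum_X_mul_pderiv
  rw [Fin.sum_univ_three, nsmul_eq_mul] at hE
  have hE0 := congrArg restrictLine (congrArg (pderiv 0) hE)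
  have hE2 := congrArg restrictLine (congrArg (pderiv 2) hE)
  have hE := congrArg restrictLine hE
  have hL := congrArg restrictLine hlap
  simp only [laplace_apply, Fin.sum_univ_three, pderiv_mul, map_add, map_sub, map_mul, x01, x02,
    x10, x20, x21, pderiv_X_self, rX, rY, rZ, map_zero, pderiv_natCast, map_natCast,
    ← derivative_restrictLine, pderiv_comm (2 : Fin 3) 0, zero_mul, one_mul, zero_add, add_zero]
    at hD1 hE hE0 hE2 hL
  have hz : restrictLine p = 0 := by
    apply LegendrePolynomial.eq_zero_of_zonal_ode n
    · rw [Polynomial.coeff_zero_eq_eval_zero, eval_restrictLine, h0]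
    · simp only [map_mul, map_sub, map_one, map_natCast, map_ofNat Polynomial.C 2]
      linear_combination Polynomial.X * hL - hD1 - Polynomial.X * hE2
        - ((n : Polynomial ℝ) - 1) * Polynomial.X * hE + Polynomial.X ^ 2 * hE0
  -- Scaling from the plane `z = 1` reaches only points with `z ≠ 0`; the factor `z` covers the
  -- rest.
  have hX : X 2 * p = 0 := by
    apply MvPolynomial.funext
    intro x
    rw [map_mul, eval_X, map_zero]
    by_cases h2 : x 2 = 0
    · rw [h2, zero_mul]
    -- Polar coordinates in the horizontal plane: the argument of `w` is the angle that rotates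
    -- `(|w|, 0)` to `(x 0, x 1)`.
    set w : ℂ := ⟨x 0, x 1⟩ with hw
    have hr := hrot ‖w‖ 0 (x 2) (Complex.arg w)
    have e0 : ‖w‖ * Real.cos (Complex.arg w) = x 0 := Complex.norm_mul_cos_arg w
    have e1 : ‖w‖ * Real.sin (Complex.arg w) = x 1 := Complex.norm_mul_sin_arg w
    have hx : ![x 0, x 1, x 2] = x := by ext i; fin_cases i <;> rfl
    simp only [e0, e1, zero_mul, sub_zero, add_zero, hx] at hr
    have h3 := hhom.eval_mul (x 2) ![‖w‖ / x 2, 0, 1]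
    have h4 : (fun i => x 2 * ![‖w‖ / x 2, 0, 1] i) = ![‖w‖, 0, x 2] := by
      ext i
      fin_cases i <;> simp
      field_simp
    rw [h4, ← eval_restrictLine, hz, Polynomial.eval_zero, mul_zero] at h3
    rw [hr, h3, mul_zero]
  exact (mul_eq_zero.1 hX).resolve_left (X_ne_zero 2)

end MvPolynomial

/-! ### Rotation invariance of the surface measure -/

namespace SphericalHarmonic

open MvPolynomial Metric

/-- The action of a linear isometry on the unit sphere. -/
noncomputable def sphereEquiv (A : E3 ≃ₗᵢ[ℝ] E3) : sphere (0 : E3) 1 ≃ₜ sphere (0 : E3) 1 where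
  toFun ξ := ⟨A ξ, by simp⟩
  invFun ξ := ⟨A.symm ξ, by simp⟩
  left_inv ξ := by simp
  right_inv ξ := by simp
  continuous_toFun := by fun_prop
  continuous_invFun := by fun_prop

-- The surface measure of `s` is, up to a factor, the volume of the cone `(0, 1) • s`; isometries
-- map cones to cones and preserve volume.
open scoped Pointwise in
theorem measurePreserving_sphereEquiv (A : E3 ≃ₗᵢ[ℝ] E3) :
    MeasurePreserving (sphereEquiv A) (volume : Measure E3).toSphere
      (volume : Measure E3).toSphere := by
  refine ⟨(sphereEquiv A).continuous.measurable, ?_⟩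
  ext s hs
  rw [Measure.map_apply (sphereEquiv A).continuous.measurable hs,
    Measure.toSphere_apply' _ hs, Measure.toSphere_apply' _
      ((sphereEquiv A).continuous.measurable hs)]
  congr 1
  have h : Set.Ioo (0 : ℝ) 1 • ((↑) '' (sphereEquiv A ⁻¹' s) : Set E3) =
      A ⁻¹' (Set.Ioo (0 : ℝ) 1 • ((↑) '' s : Set E3)) := by
    ext x
    simp only [Set.mem_smul, Set.mem_image, Set.mem_preimage]
    constructor
    · rintro ⟨a, ha, _, ⟨ξ, hξ, rfl⟩, rfl⟩
      exact ⟨a, ha, _, ⟨_, hξ, rfl⟩, by simp [sphereEquiv]⟩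
    · rintro ⟨a, ha, _, ⟨ξ, hξ, rfl⟩, hx⟩
      refine ⟨a, ha, _, ⟨(sphereEquiv A).symm ξ, by simpa using hξ, rfl⟩, ?_⟩
      apply A.injective
      rw [← hx]
      simp [sphereEquiv]
  rw [h]
  exact A.measurePreserving.measure_preimage_emb A.toHomeomorph.measurableEmbedding _

theorem continuous_eval_sphere (p : MvPolynomial (Fin 3) ℝ) :
    Continuous fun ξ : sphere (0 : E3) 1 => eval (ξ : E3).ofLp p := by
  have h : Continuous fun ξ : sphere (0 : E3) 1 => (ξ : E3).ofLp := by fun_prop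
  exact p.continuous_eval.comp h

theorem integrable_eval_sphere (p : MvPolynomial (Fin 3) ℝ) :
    Integrable (fun ξ : sphere (0 : E3) 1 => eval (ξ : E3).ofLp p)
      (volume : Measure E3).toSphere :=
  (continuous_eval_sphere p).integrable_of_hasCompactSupport
    (HasCompactSupport.of_compactSpace _)

/-- The integral of a polynomial over the unit sphere. -/
noncomputable def sphereIntegral : MvPolynomial (Fin 3) ℝ →ₗ[ℝ] ℝ where
  toFun p := ∫ ξ : sphere (0 : E3) 1, eval (ξ : E3).ofLp p ∂(volume : Measure E3).toSphere
  map_add' p q := by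
    simp only [map_add]
    exact integral_add (integrable_eval_sphere p) (integrable_eval_sphere q)
  map_smul' a p := by
    simp only [smul_eval, RingHom.id_apply, smul_eq_mul]
    exact integral_const_mul _ _

/-- The matrix of a linear isometry. -/
noncomputable def isometryMatrix (A : E3 ≃ₗᵢ[ℝ] E3) : Matrix (Fin 3) (Fin 3) ℝ :=
  Matrix.of fun i j => A (EuclideanSpace.single j 1) i

theorem isometryMatrix_mulVec (A : E3 ≃ₗᵢ[ℝ] E3) (x : E3) :
    (isometryMatrix A).mulVec x.ofLp = (A x).ofLp := by
  have hx : x = ∑ j, x j • EuclideanSpace.single j (1 : ℝ) := by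
    ext i
    fin_cases i <;> simp [Fin.sum_univ_three]
  ext i
  conv_rhs => rw [hx, map_sum]
  simp [isometryMatrix, Matrix.mulVec, dotProduct, mul_comm]

theorem isometryMatrix_mul_transpose (A : E3 ≃ₗᵢ[ℝ] E3) :
    isometryMatrix A * (isometryMatrix A).transpose = 1 := by
  rw [mul_eq_one_comm]
  ext j k
  have h : inner ℝ (A (EuclideanSpace.single k 1)) (A (EuclideanSpace.single j (1 : ℝ))) =
      inner ℝ (EuclideanSpace.single k (1 : ℝ)) (EuclideanSpace.single j (1 : ℝ)) :=
    A.inner_map_map _ _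
  rw [PiLp.inner_apply] at h
  simpa [Matrix.mul_apply, isometryMatrix, Matrix.one_apply, EuclideanSpace.inner_single_left,
    Pi.single_apply, @eq_comm _ j k] using h

theorem sphereIntegral_linearSubst (A : E3 ≃ₗᵢ[ℝ] E3) (p : MvPolynomial (Fin 3) ℝ) :
    sphereIntegral (linearSubst (isometryMatrix A) p) = sphereIntegral p := by
  simp only [sphereIntegral, LinearMap.coe_mk, AddHom.coe_mk, eval_linearSubst,
    isometryMatrix_mulVec]
  exact (measurePreserving_sphereEquiv A).integral_comp (sphereEquiv A).measurableEmbedding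
    (fun ξ : sphere (0 : E3) 1 => eval (ξ : E3).ofLp p)

/-! ### The addition theorem -/

section Addition

variable {n : ℕ} {q : Fin (2 * n + 1) → MvPolynomial (Fin 3) ℝ}

/-- Orthonormality gives independence, and `2n + 1` independent vectors span a space of dimension at
most `2n + 1`. -/
theorem exists_eq_sum_of_orthonormal (hq : ∀ k, q k ∈ harmonicSubmodule n)
    (ho : ∀ k l, sphereIntegral (q k * q l) = if k = l then 1 else 0)
    {p : MvPolynomial (Fin 3) ℝ} (hp : p ∈ harmonicSubmodule n) :
    ∃ c : Fin (2 * n + 1) → ℝ, p = ∑ k, c k • q k := by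
  let b : Fin (2 * n + 1) → harmonicSubmodule n := fun k => ⟨q k, hq k⟩
  have hb : LinearIndependent ℝ b := by
    rw [Fintype.linearIndependent_iff]
    intro g hg l
    have h1 : ∑ k, g k • q k = 0 := by
      simpa [b] using congrArg Subtype.val hg
    have h2 := congrArg (fun r => sphereIntegral (r * q l)) h1
    simpa [Finset.sum_mul, ho] using h2
  have hspan : Submodule.span ℝ (Set.range b) = ⊤ := by
    apply hb.span_eq_top_of_card_eq_finrank
    apply le_antisymm hb.fintype_card_le_finrank
    simpa using finrank_harmonicSubmodule_le n
  have hmem : (⟨p, hp⟩ : harmonicSubmodule n) ∈ Submodule.span ℝ (Set.range b) := by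
    rw [hspan]; trivial
  obtain ⟨c, hc⟩ := (Submodule.mem_span_range_iff_exists_fun ℝ).1 hmem
  refine ⟨c, ?_⟩
  simpa [b] using (congrArg Subtype.val hc).symm

/-- An isometry preserves both the space of harmonics and the integral, hence acts on the
orthonormal basis by an orthogonal matrix, which preserves dot products. -/
theorem sum_mul_isometry (hq : ∀ k, q k ∈ harmonicSubmodule n)
    (ho : ∀ k l, sphereIntegral (q k * q l) = if k = l then 1 else 0)
    (A : E3 ≃ₗᵢ[ℝ] E3) (ξ η : E3) :
    ∑ k, eval (A ξ).ofLp (q k) * eval (A η).ofLp (q k) =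
      ∑ k, eval ξ.ofLp (q k) * eval η.ofLp (q k) := by
  have h1 : ∀ k, ∃ c : Fin (2 * n + 1) → ℝ,
      linearSubst (isometryMatrix A) (q k) = ∑ l, c l • q l := fun k =>
    exists_eq_sum_of_orthonormal hq ho
      (linearSubst_mem_harmonicSubmodule (isometryMatrix_mul_transpose A) (hq k))
  choose U hU using h1
  let V : Matrix (Fin (2 * n + 1)) (Fin (2 * n + 1)) ℝ := Matrix.of U
  have hV : V * V.transpose = 1 := by
    ext k k'
    have h2 := sphereIntegral_linearSubst A (q k * q k')
    rw [map_mul, hU, hU, ho, Finset.sum_mul_sum] at h2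
    simp only [smul_mul_smul_comm, map_sum, map_smul, ho, smul_eq_mul, mul_ite, mul_one,
      mul_zero, Finset.sum_ite_eq, Finset.mem_univ, if_true] at h2
    simpa [Matrix.mul_apply, Matrix.one_apply, V] using h2
  rw [mul_eq_one_comm] at hV
  have h3 : ∀ x : E3, (fun k => eval (A x).ofLp (q k)) = V.mulVec fun k => eval x.ofLp (q k) := by
    intro x
    ext k
    rw [← isometryMatrix_mulVec, ← eval_linearSubst, hU]
    simp [V, Matrix.mulVec, dotProduct]
  have h4 : ∀ x y : E3, ∑ k, eval x.ofLp (q k) * eval y.ofLp (q k) =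
      (fun k => eval x.ofLp (q k)) ⬝ᵥ (fun k => eval y.ofLp (q k)) := fun x y => rfl
  rw [h4, h4, h3, h3, Matrix.dotProduct_mulVec, Matrix.vecMul_mulVec, hV, Matrix.vecMul_one]

/-- Two reflections suffice: the first takes `ξ` to `ξ'`; the second takes `A η` to `η'` and fixes
`ξ'`, because equality of the inner products makes `ξ'` orthogonal to `A η - η'`. -/
theorem exists_isometry {ξ η ξ' η' : E3} (hξ : ‖ξ‖ = ‖ξ'‖) (hη : ‖η‖ = ‖η'‖)
    (h : inner ℝ ξ η = inner ℝ ξ' η') : ∃ A : E3 ≃ₗᵢ[ℝ] E3, A ξ = ξ' ∧ A η = η' := by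
  set A := (Submodule.span ℝ {ξ - ξ'})ᗮ.reflection with hA
  have hAξ : A ξ = ξ' := Submodule.reflection_sub hξ
  set B := (Submodule.span ℝ {A η - η'})ᗮ.reflection with hB
  have hBη : B (A η) = η' := Submodule.reflection_sub (by rw [A.norm_map, hη])
  refine ⟨A.trans B, ?_, hBη⟩
  change B (A ξ) = ξ'
  rw [hAξ]
  apply Submodule.reflection_mem_subspace_eq_self
  rw [Submodule.mem_orthogonal_singleton_iff_inner_right, inner_sub_left, real_inner_comm,
    ← hAξ, A.inner_map_map, h, hAξ, real_inner_comm, sub_self]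

theorem sum_mul_eq_of_inner_eq (hq : ∀ k, q k ∈ harmonicSubmodule n)
    (ho : ∀ k l, sphereIntegral (q k * q l) = if k = l then 1 else 0)
    {ξ η ξ' η' : E3} (hξ : ‖ξ‖ = ‖ξ'‖) (hη : ‖η‖ = ‖η'‖) (h : inner ℝ ξ η = inner ℝ ξ' η') :
    ∑ k, eval ξ.ofLp (q k) * eval η.ofLp (q k) =
      ∑ k, eval ξ'.ofLp (q k) * eval η'.ofLp (q k) := by
  obtain ⟨A, rfl, rfl⟩ := exists_isometry hξ hη h
  exact (sum_mul_isometry hq ho A ξ η).symm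

/-- Both sides are invariant under rotation about the third axis and agree at the pole, so their
difference is zero by uniqueness of zonal harmonics. -/
theorem eval_sum_smul_eq (hq : ∀ k, q k ∈ harmonicSubmodule n)
    (ho : ∀ k l, sphereIntegral (q k * q l) = if k = l then 1 else 0) :
    ∑ k, eval ![0, 0, 1] (q k) • q k =
      (∑ k, eval ![0, 0, 1] (q k) * eval ![0, 0, 1] (q k)) • solidLegendre n := by
  rw [← sub_eq_zero]
  set e : E3 := !₂[0, 0, 1] with he
  have heL : e.ofLp = ![0, 0, 1] := rfl
  apply eq_zero_of_zonal (n := n)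
  · exact Submodule.sub_mem _ (Submodule.sum_mem _ fun k _ => Submodule.smul_mem _ _ (hq k))
      (Submodule.smul_mem _ _ (solidLegendre_mem n))
  · intro x y z s
    set v : E3 := !₂[x, y, z] with hv
    set w : E3 := !₂[x * Real.cos s - y * Real.sin s, x * Real.sin s + y * Real.cos s, z] with hw
    have hvL : v.ofLp = ![x, y, z] := rfl
    have hwL : w.ofLp = ![x * Real.cos s - y * Real.sin s,
      x * Real.sin s + y * Real.cos s, z] := rfl
    have hnorm : ‖w‖ = ‖v‖ := by
      rw [EuclideanSpace.norm_eq, EuclideanSpace.norm_eq]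
      congr 1
      simp [Fin.sum_univ_three, hv, hw]
      linear_combination (x ^ 2 + y ^ 2) * Real.sin_sq_add_cos_sq s
    have h1 := sum_mul_eq_of_inner_eq hq ho (ξ := e) (ξ' := e) (η := w) (η' := v) rfl hnorm
      (by simp [PiLp.inner_apply, Fin.sum_univ_three, he, hv, hw])
    have h2 : ∀ m : ℕ, eval w.ofLp (solidLegendre m) = eval v.ofLp (solidLegendre m) := by
      intro m
      induction m using Nat.strong_induction_on with
      | _ m ih =>
        match m, ih with
        | 0, _ => simp [solidLegendre_zero]
        | 1, _ => simp [solidLegendre_one, hvL, hwL]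
        | m + 2, ih =>
          rw [solidLegendre]
          simp only [map_sub, map_mul, eval_C, eval_X, map_add, map_pow, ih m (by omega),
            ih (m + 1) (by omega)]
          simp [hvL, hwL]
          left; left; left
          linear_combination (x ^ 2 + y ^ 2) * Real.sin_sq_add_cos_sq s
    rw [← hvL, ← hwL]
    simp only [map_sub, map_sum, smul_eval, ← heL, h1, h2]
  · have h2 : eval ![0, 0, 1] (solidLegendre n) = 1 := by
      rw [eval_solidLegendre n (by simp)]
      simpa using LegendrePolynomial.legendre_eval_one n
    simp [h2]

theorem sum_mul_eq_legendre (hq : ∀ k, q k ∈ harmonicSubmodule n)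
    (ho : ∀ k l, sphereIntegral (q k * q l) = if k = l then 1 else 0)
    {ξ η : E3} (hξ : ‖ξ‖ = 1) (hη : ‖η‖ = 1) :
    ∑ k, eval ξ.ofLp (q k) * eval η.ofLp (q k) =
      (∑ k, eval ![0, 0, 1] (q k) * eval ![0, 0, 1] (q k)) *
        (LegendrePolynomial.legendre n).eval (inner ℝ ξ η) := by
  set e : E3 := !₂[0, 0, 1] with he
  set t : ℝ := inner ℝ ξ η with ht
  set w : E3 := !₂[Real.sqrt (1 - t ^ 2), 0, t] with hw
  have ht1 : 0 ≤ 1 - t ^ 2 := by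
    have := abs_real_inner_le_norm ξ η
    rw [hξ, hη, mul_one, ← ht] at this
    nlinarith [abs_le.1 this]
  have hsq := Real.sq_sqrt ht1
  have hwn : ‖w‖ = 1 := by
    rw [EuclideanSpace.norm_eq]
    simp [Fin.sum_univ_three, hw, hsq]
  have hen : ‖e‖ = 1 := by
    rw [EuclideanSpace.norm_eq]
    simp [Fin.sum_univ_three, he]
  rw [sum_mul_eq_of_inner_eq hq ho (hξ.trans hen.symm) (hη.trans hwn.symm)
    (show inner ℝ ξ η = inner ℝ e w by
      simp [PiLp.inner_apply, Fin.sum_univ_three, he, hw, ht])]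
  have h1 := congrArg (eval w.ofLp) (eval_sum_smul_eq hq ho)
  rw [smul_eval, eval_solidLegendre n (by simp [hw, hsq]), map_sum] at h1
  simp only [smul_eval] at h1
  exact h1

end Addition

/-- The reciprocal of the area of the unit sphere. -/
noncomputable def areaInv : ℝ := ((volume : Measure E3).toSphere.real Set.univ)⁻¹

theorem area_pos : 0 < (volume : Measure E3).toSphere.real Set.univ := by
  rw [measureReal_def, ENNReal.toReal_pos_iff]
  refine ⟨?_, measure_lt_top _ _⟩
  rw [pos_iff_ne_zero, Ne, Measure.measure_univ_eq_zero]
  exact Measure.toSphere_ne_zero _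

theorem areaInv_pos : 0 < areaInv := inv_pos.2 area_pos

theorem exists_polynomials {Y : (n : ℕ) → Fin (2 * n + 1) → E3 → ℝ}
    (hY : IsOrthonormalSphericalHarmonics Y) (n : ℕ) :
    ∃ q : Fin (2 * n + 1) → MvPolynomial (Fin 3) ℝ, (∀ k, q k ∈ harmonicSubmodule n) ∧
      (∀ k l, sphereIntegral (q k * q l) = if k = l then 1 else 0) ∧
      ∀ k, ∀ ξ : E3, ‖ξ‖ = 1 → Y n k ξ = eval ξ.ofLp (q k) := by
  choose q hhom hlap heq using hY.harmonic n
  refine ⟨q, fun k => mem_harmonicSubmodule.2 ⟨hhom k, by rw [laplace_apply, hlap]⟩, ?_, heq⟩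
  intro k l
  have h := hY.orthonormal ⟨n, k⟩ ⟨n, l⟩
  have h1 : ∀ ξ : sphere (0 : E3) 1, Y n k ξ * Y n l ξ = eval (ξ : E3).ofLp (q k * q l) := by
    intro ξ
    have hξ : ‖(ξ : E3)‖ = 1 := by simp
    rw [heq k ξ hξ, heq l ξ hξ, map_mul]
  simp only [h1] at h
  rw [sphereIntegral, LinearMap.coe_mk, AddHom.coe_mk, h]
  simp

/-- The addition theorem for spherical harmonics. -/
theorem addition_theorem {Y : (n : ℕ) → Fin (2 * n + 1) → E3 → ℝ}
    (hY : IsOrthonormalSphericalHarmonics Y) (n : ℕ) {ξ η : E3} (hξ : ‖ξ‖ = 1) (hη : ‖η‖ = 1) :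
    ∑ k, Y n k ξ * Y n k η =
      areaInv * (2 * n + 1) * (LegendrePolynomial.legendre n).eval (inner ℝ ξ η) := by
  obtain ⟨q, hq, ho, heq⟩ := exists_polynomials hY n
  simp only [heq _ _ hξ, heq _ _ hη]
  rw [sum_mul_eq_legendre hq ho hξ hη]
  congr 1
  set a := ∑ k, eval ![0, 0, 1] (q k) * eval ![0, 0, 1] (q k) with ha
  -- The constant is found by integrating the diagonal of the reproducing kernel, which is constant
  -- on the sphere because `P_n(1) = 1`.
  have h1 : sphereIntegral (∑ k, q k * q k) = 2 * n + 1 := by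
    rw [map_sum]
    simp [ho]
  have h2 : sphereIntegral (∑ k, q k * q k) =
      (volume : Measure E3).toSphere.real Set.univ * a := by
    have h3 : ∀ ζ : sphere (0 : E3) 1, eval (ζ : E3).ofLp (∑ k, q k * q k) = a := by
      intro ζ
      have hζ : ‖(ζ : E3)‖ = 1 := by simp
      have := sum_mul_eq_legendre hq ho hζ hζ
      rw [real_inner_self_eq_norm_sq, hζ, one_pow, LegendrePolynomial.legendre_eval_one,
        mul_one] at this
      rw [ha, ← this, map_sum]
      simp
    simp only [sphereIntegral, LinearMap.coe_mk, AddHom.coe_mk, h3]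
    simp
  have h4 := area_pos
  rw [areaInv, inv_mul_eq_div, eq_div_iff h4.ne', mul_comm, ← h2, h1]

end SphericalHarmonic

/-! ### Surface gradients and the zonal form of the kernel -/

namespace SphericalHarmonic

open MvPolynomial LegendrePolynomial

variable {Y : (n : ℕ) → Fin (2 * n + 1) → E3 → ℝ}

theorem differentiable_eval (p : MvPolynomial (Fin 3) ℝ) :
    Differentiable ℝ fun x : E3 => eval x.ofLp p := by
  induction p using MvPolynomial.induction_on with
  | C a => simp
  | add p q hp hq =>
    simp only [map_add]
    exact hp.fun_add hq
  | mul_X p j hp =>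
    simp only [map_mul, eval_X]
    exact hp.mul (by fun_prop)

/-- `Y n k` is arbitrary off the sphere, but after radial projection it agrees near `ξ` with a
polynomial composed with a smooth map. -/
theorem differentiableAt_radial (hY : IsOrthonormalSphericalHarmonics Y) (n : ℕ)
    (k : Fin (2 * n + 1)) {ξ : E3} (hξ : ‖ξ‖ = 1) :
    DifferentiableAt ℝ (fun x : E3 => Y n k (‖x‖⁻¹ • x)) ξ := by
  obtain ⟨q, -, -, heq⟩ := exists_polynomials hY n
  have hξ0 : ξ ≠ 0 := by
    rintro rfl
    simp at hξ
  have h1 : (fun x : E3 => Y n k (‖x‖⁻¹ • x)) =ᶠ[𝓝 ξ]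
      fun x : E3 => eval (‖x‖⁻¹ • x).ofLp (q k) := by
    filter_upwards [isOpen_ne.mem_nhds hξ0] with x hx
    exact heq k _ (norm_smul_inv_norm hx)
  refine DifferentiableAt.congr_of_eventuallyEq ?_ h1
  have h2 : DifferentiableAt ℝ (fun x : E3 => ‖x‖⁻¹ • x) ξ :=
    ((differentiableAt_id.norm ℝ hξ0).inv (norm_ne_zero_iff.2 hξ0)).smul differentiableAt_id
  exact (differentiable_eval (q k)).differentiableAt.comp ξ h2

theorem hasDerivAt_radial_comp (hY : IsOrthonormalSphericalHarmonics Y) (n : ℕ)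
    (k : Fin (2 * n + 1)) {ξ v : E3} (hξ : ‖ξ‖ = 1) {γ : ℝ → E3} (hγ : HasDerivAt γ v 0)
    (hγ0 : γ 0 = ξ) :
    HasDerivAt (fun s => Y n k (‖γ s‖⁻¹ • γ s)) (inner ℝ (surfaceGradient (Y n k) ξ) v) 0 := by
  have h1 := (differentiableAt_radial hY n k hξ).hasGradientAt.hasFDerivAt
  rw [← hγ0] at h1
  have h2 := h1.comp_hasDerivAt (0 : ℝ) hγ
  rw [hγ0] at h2
  exact h2

theorem norm_circle {ξ v : E3} (hξ : ‖ξ‖ = 1) (hv : ‖v‖ = 1) (hξv : inner ℝ ξ v = 0) (s : ℝ) :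
    ‖Real.cos s • ξ + Real.sin s • v‖ = 1 := by
  have h : ‖Real.cos s • ξ + Real.sin s • v‖ ^ 2 = 1 := by
    rw [norm_add_sq_real, norm_smul, norm_smul, inner_smul_left, inner_smul_right, hξ, hv, hξv]
    simp
  nlinarith [norm_nonneg (Real.cos s • ξ + Real.sin s • v)]

theorem hasDerivAt_circle (ξ v : E3) :
    HasDerivAt (fun s : ℝ => Real.cos s • ξ + Real.sin s • v) v 0 := by
  simpa using ((Real.hasDerivAt_cos 0).smul_const ξ).fun_add
    ((Real.hasDerivAt_sin 0).smul_const v)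

theorem hasDerivAt_harmonic_circle (hY : IsOrthonormalSphericalHarmonics Y) (n : ℕ)
    (k : Fin (2 * n + 1)) {ξ v : E3} (hξ : ‖ξ‖ = 1) (hv : ‖v‖ = 1) (hξv : inner ℝ ξ v = 0) :
    HasDerivAt (fun s : ℝ => Y n k (Real.cos s • ξ + Real.sin s • v))
      (inner ℝ (surfaceGradient (Y n k) ξ) v) 0 := by
  have := hasDerivAt_radial_comp hY n k hξ (hasDerivAt_circle ξ v) (by simp)
  simpa [norm_circle hξ hv hξv] using this

/-- The surface gradient is tangential. -/
theorem inner_surfaceGradient_self (hY : IsOrthonormalSphericalHarmonics Y) (n : ℕ)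
    (k : Fin (2 * n + 1)) {ξ : E3} (hξ : ‖ξ‖ = 1) :
    inner ℝ (surfaceGradient (Y n k) ξ) ξ = 0 := by
  have hγ : HasDerivAt (fun s : ℝ => Real.exp s • ξ) ξ 0 := by
    simpa using (Real.hasDerivAt_exp 0).smul_const ξ
  have h1 := hasDerivAt_radial_comp hY n k hξ hγ (by simp)
  have h2 : ∀ s : ℝ, ‖Real.exp s • ξ‖⁻¹ • Real.exp s • ξ = ξ := by
    intro s
    rw [norm_smul, hξ, mul_one, Real.norm_eq_abs, abs_of_pos (Real.exp_pos s), smul_smul,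
      inv_mul_cancel₀ (Real.exp_pos s).ne', one_smul]
  simp only [h2] at h1
  exact h1.unique (hasDerivAt_const _ _)

theorem hasDerivAt_eval_circle (p : Polynomial ℝ) (ξ η v : E3) :
    HasDerivAt (fun s : ℝ => p.eval (inner ℝ ξ (Real.cos s • η + Real.sin s • v)))
      (p.derivative.eval (inner ℝ ξ η) * inner ℝ ξ v) 0 := by
  have h1 : HasDerivAt (fun s : ℝ => inner ℝ ξ (Real.cos s • η + Real.sin s • v))
      (inner ℝ ξ v) 0 := by
    simpa using (hasDerivAt_const (0 : ℝ) ξ).inner ℝ (hasDerivAt_circle η v)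
  have h2 := p.hasDerivAt (inner ℝ ξ (Real.cos (0 : ℝ) • η + Real.sin (0 : ℝ) • v))
  have h3 := h2.comp (0 : ℝ) h1
  simp only [Real.cos_zero, Real.sin_zero, one_smul, zero_smul, add_zero] at h3
  exact h3

/-- Differentiate the addition theorem in `η` along the great circle with velocity `v`; derivatives
are unique. The next result differentiates once more, in `ξ` along `u`. -/
theorem sum_mul_inner_surfaceGradient (hY : IsOrthonormalSphericalHarmonics Y) (n : ℕ)
    {ξ η v : E3} (hξ : ‖ξ‖ = 1) (hη : ‖η‖ = 1) (hv : ‖v‖ = 1) (hηv : inner ℝ η v = 0) :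
    ∑ k, Y n k ξ * inner ℝ (surfaceGradient (Y n k) η) v =
      areaInv * (2 * n + 1) *
        ((legendre n).derivative.eval (inner ℝ ξ η) * inner ℝ ξ v) := by
  have h1 := HasDerivAt.fun_sum (u := Finset.univ) fun k _ =>
    (hasDerivAt_harmonic_circle hY n k hη hv hηv).const_mul (Y n k ξ)
  have h2 := (hasDerivAt_eval_circle (legendre n) ξ η v).const_mul (areaInv * (2 * n + 1))
  refine h1.unique (h2.congr_of_eventuallyEq (Eventually.of_forall fun s => ?_))
  exact addition_theorem hY n hξ (norm_circle hη hv hηv s)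

theorem sum_inner_surfaceGradient_mul (hY : IsOrthonormalSphericalHarmonics Y) (n : ℕ)
    {ξ η u v : E3} (hξ : ‖ξ‖ = 1) (hη : ‖η‖ = 1) (hu : ‖u‖ = 1) (hv : ‖v‖ = 1)
    (hξu : inner ℝ ξ u = 0) (hηv : inner ℝ η v = 0) :
    ∑ k, inner ℝ (surfaceGradient (Y n k) ξ) u * inner ℝ (surfaceGradient (Y n k) η) v =
      areaInv * (2 * n + 1) *
        ((legendre n).derivative.derivative.eval (inner ℝ ξ η) * inner ℝ u η * inner ℝ ξ v
          + (legendre n).derivative.eval (inner ℝ ξ η) * inner ℝ u v) := by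
  have h1 := HasDerivAt.fun_sum (u := Finset.univ) fun k _ =>
    (hasDerivAt_harmonic_circle hY n k hξ hu hξu).mul_const
      (inner ℝ (surfaceGradient (Y n k) η) v)
  have h2 : HasDerivAt (fun s : ℝ => inner ℝ v (Real.cos s • ξ + Real.sin s • u))
      (inner ℝ v u) 0 := by
    simpa using (hasDerivAt_const (0 : ℝ) v).inner ℝ (hasDerivAt_circle ξ u)
  have h3 := ((hasDerivAt_eval_circle (legendre n).derivative η ξ u).fun_mul h2).const_mul
    (areaInv * (2 * n + 1))
  refine h1.unique ((h3.congr_of_eventuallyEq (Eventually.of_forall fun s => ?_)).congr_deriv ?_)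
  · simp only
    rw [sum_mul_inner_surfaceGradient hY n (norm_circle hξ hu hξu s) hη hv hηv,
      real_inner_comm η, real_inner_comm v]
  · simp only [Real.cos_zero, Real.sin_zero, one_smul, zero_smul, add_zero]
    rw [real_inner_comm ξ η, real_inner_comm u η, real_inner_comm ξ v, real_inner_comm u v]

theorem inner_three (x y : E3) : inner ℝ x y = x 0 * y 0 + x 1 * y 1 + x 2 * y 2 := by
  simp [PiLp.inner_apply, Fin.sum_univ_three]
  ring

theorem norm_eq_one_three {x : E3} (h : x 0 ^ 2 + x 1 ^ 2 + x 2 ^ 2 = 1) : ‖x‖ = 1 := by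
  rw [EuclideanSpace.norm_eq]
  simp [Fin.sum_univ_three, h]

/-- Gradients are tangential, so they are determined by their components in the frames `e₁, e₂` at
the pole and `v, e₂` at the second point. The mixed components sum to zero, which leaves one term
along the great circle and one across it. -/
theorem sum_surfaceGradient_mul (hY : IsOrthonormalSphericalHarmonics Y) (n : ℕ)
    {s t : ℝ} (hst : s ^ 2 + t ^ 2 = 1) (i j : Fin 3) :
    ∑ k, surfaceGradient (Y n k) !₂[0, 0, 1] i * surfaceGradient (Y n k) !₂[s, 0, t] j =
      areaInv * (2 * n + 1) *
        ((t * (legendre n).derivative.eval t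
            - (1 - t ^ 2) * (legendre n).derivative.derivative.eval t)
            * (![1, 0, 0] i * ![t, 0, -s] j)
          + (legendre n).derivative.eval t * (![0, 1, 0] i * ![0, 1, 0] j)) := by
  set ξ : E3 := !₂[0, 0, 1] with hξ
  set η : E3 := !₂[s, 0, t] with hη
  set e₁ : E3 := !₂[1, 0, 0] with he₁
  set e₂ : E3 := !₂[0, 1, 0] with he₂
  set v : E3 := !₂[t, 0, -s] with hv
  have nξ : ‖ξ‖ = 1 := norm_eq_one_three (by simp [hξ])
  have nη : ‖η‖ = 1 := norm_eq_one_three (by simp [hη, hst])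
  have n₁ : ‖e₁‖ = 1 := norm_eq_one_three (by simp [he₁])
  have n₂ : ‖e₂‖ = 1 := norm_eq_one_three (by simp [he₂])
  have nv : ‖v‖ = 1 := norm_eq_one_three (by simp [hv]; linarith)
  have g2 : ∀ k, surfaceGradient (Y n k) ξ 2 = 0 := by
    intro k
    have := inner_surfaceGradient_self hY n k nξ
    rw [inner_three] at this
    simpa [hξ] using this
  have h0 : ∀ k, surfaceGradient (Y n k) η 0 * s + surfaceGradient (Y n k) η 2 * t = 0 := by
    intro k
    have := inner_surfaceGradient_self hY n k nη
    rw [inner_three] at this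
    simpa [hη] using this
  have s11 := sum_inner_surfaceGradient_mul hY n nξ nη n₁ nv
    (by simp [inner_three, hξ, he₁]) (by simp [inner_three, hη, hv]; ring)
  have s12 := sum_inner_surfaceGradient_mul hY n nξ nη n₁ n₂
    (by simp [inner_three, hξ, he₁]) (by simp [inner_three, hη, he₂])
  have s21 := sum_inner_surfaceGradient_mul hY n nξ nη n₂ nv
    (by simp [inner_three, hξ, he₂]) (by simp [inner_three, hη, hv]; ring)
  have s22 := sum_inner_surfaceGradient_mul hY n nξ nη n₂ n₂
    (by simp [inner_three, hξ, he₂]) (by simp [inner_three, hη, he₂])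
  have hs : 1 - t ^ 2 = s ^ 2 := by linarith
  have iv : ∀ k, inner ℝ (surfaceGradient (Y n k) η) v =
      surfaceGradient (Y n k) η 0 * t - surfaceGradient (Y n k) η 2 * s := by
    intro k
    simp [inner_three, hv]
    ring
  have c0 : ∀ k, surfaceGradient (Y n k) η 0 =
      t * inner ℝ (surfaceGradient (Y n k) η) v := by
    intro k
    rw [iv]
    linear_combination s * h0 k - surfaceGradient (Y n k) η 0 * hst
  have c2 : ∀ k, surfaceGradient (Y n k) η 2 =
      -s * inner ℝ (surfaceGradient (Y n k) η) v := by
    intro k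
    rw [iv]
    linear_combination t * h0 k - surfaceGradient (Y n k) η 2 * hst
  have c1 : ∀ k, surfaceGradient (Y n k) η 1 = inner ℝ (surfaceGradient (Y n k) η) e₂ := by
    intro k
    simp [inner_three, he₂]
  have d0 : ∀ k, surfaceGradient (Y n k) ξ 0 = inner ℝ (surfaceGradient (Y n k) ξ) e₁ := by
    intro k
    simp [inner_three, he₁]
  have d1 : ∀ k, surfaceGradient (Y n k) ξ 1 = inner ℝ (surfaceGradient (Y n k) ξ) e₂ := by
    intro k
    simp [inner_three, he₂]
  have i1 : inner ℝ ξ η = t := by simp [inner_three, hξ, hη]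
  have i2 : inner ℝ e₁ η = s := by simp [inner_three, he₁, hη]
  have i3 : inner ℝ ξ v = -s := by simp [inner_three, hξ, hv]
  have i4 : inner ℝ e₁ v = t := by simp [inner_three, he₁, hv]
  have i5 : inner ℝ ξ e₂ = 0 := by simp [inner_three, hξ, he₂]
  have i6 : inner ℝ e₁ e₂ = 0 := by simp [inner_three, he₁, he₂]
  have i7 : inner ℝ e₂ η = 0 := by simp [inner_three, he₂, hη]
  have i8 : inner ℝ e₂ v = 0 := by simp [inner_three, he₂, hv]
  have i9 : inner ℝ e₂ e₂ = (1 : ℝ) := by rw [real_inner_self_eq_norm_sq, n₂, one_pow]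
  rw [i1, i2, i3, i4] at s11
  rw [i1, i5, i6] at s12
  rw [i1, i7, i8] at s21
  rw [i1, i5, i7, i9] at s22
  have p : ∀ (f g : Fin (2 * n + 1) → ℝ) (a : ℝ), ∑ k, f k * (a * g k) = a * ∑ k, f k * g k := by
    intro f g a
    rw [Finset.mul_sum]
    exact Finset.sum_congr rfl fun k _ => by ring
  fin_cases i <;> fin_cases j <;>
    simp only [Fin.zero_eta, Fin.mk_one, Fin.reduceFinMk, g2, c0, c1, c2, d0, d1, p, s11, s12,
      s21, s22, zero_mul, Finset.sum_const_zero] <;>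
    simp [hs] <;> ring

/-- Up to a constant, `|K|²` is the sum of the squares of the three nonzero components of `K` in
frames adapted to the great circle through the two points. -/
theorem zonalAbsSq_tensorKernel (hY : IsOrthonormalSphericalHarmonics Y) {r : ℝ} (hr : 0 < r)
    (L : ℕ) (ψ : ℕ → ℝ) {t : ℝ} (ht : t ∈ Set.Icc (-1 : ℝ) 1) :
    zonalAbsSq r (tensorKernel Y r L ψ) t =
      (areaInv / r ^ 2) ^ 2 * (profileSq L ψ).eval t := by
  set s := Real.sqrt (1 - t ^ 2) with hs
  have hst : s ^ 2 + t ^ 2 = 1 := by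
    rw [hs, Real.sq_sqrt (by nlinarith [ht.1, ht.2])]
    ring
  have nξ : ‖(!₂[0, 0, 1] : E3)‖ = 1 := norm_eq_one_three (by simp)
  have nη : ‖(!₂[s, 0, t] : E3)‖ = 1 := norm_eq_one_three (by simp [hst])
  have hdir : ∀ {ξ : E3}, ‖ξ‖ = 1 → ‖r • ξ‖⁻¹ • r • ξ = ξ := by
    intro ξ hξ
    rw [norm_smul, hξ, mul_one, Real.norm_eq_abs, abs_of_pos hr, smul_smul,
      inv_mul_cancel₀ hr.ne', one_smul]
  have hK : ∀ i j, tensorKernel Y r L ψ (r • !₂[0, 0, 1]) (r • !₂[s, 0, t]) i j =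
      areaInv / r ^ 2 * ((normalProfile L ψ).eval t * (![0, 0, 1] i * ![s, 0, t] j)
        + (alongProfile L ψ).eval t * (![1, 0, 0] i * ![t, 0, -s] j)
        + (crossProfile L ψ).eval t * (![0, 1, 0] i * ![0, 1, 0] j)) := by
    intro i j
    rw [tensorKernel, hdir nξ, hdir nη, Matrix.add_apply, Matrix.sum_apply, Matrix.sum_apply]
    have e1 : ∀ n, (∑ k : Fin (2 * n + 1), ψ n • tensor ((1 / r) • vecHarmonic₁ Y n k !₂[0, 0, 1])
        ((1 / r) • vecHarmonic₁ Y n k !₂[s, 0, t])) i j = areaInv / r ^ 2 *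
        ((ψ n * (2 * n + 1)) * (legendre n).eval t) * (![0, 0, 1] i * ![s, 0, t] j) := by
      intro n
      have h := addition_theorem hY n nξ nη
      have h1 : inner ℝ (!₂[0, 0, 1] : E3) !₂[s, 0, t] = t := by simp [inner_three]
      rw [h1] at h
      rw [Matrix.sum_apply]
      calc _ = ∑ k : Fin (2 * n + 1), (Y n k !₂[0, 0, 1] * Y n k !₂[s, 0, t]) *
            (ψ n / r ^ 2 * (![0, 0, 1] i * ![s, 0, t] j)) := by
            refine Finset.sum_congr rfl fun k _ => ?_
            simp [tensor, vecHarmonic₁]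
            field_simp
        _ = _ := by
            rw [← Finset.sum_mul, h]
            ring
    have e2 : ∀ n ∈ Finset.Icc 1 L, (∑ k : Fin (2 * n + 1), ψ n • tensor
        ((1 / r) • vecHarmonic₂ Y n k !₂[0, 0, 1])
        ((1 / r) • vecHarmonic₂ Y n k !₂[s, 0, t])) i j = areaInv / r ^ 2 *
        ((t * (ψ n * ((2 * n + 1) / (n * (n + 1))) * (legendre n).derivative.eval t)
          - (1 - t ^ 2) * (ψ n * ((2 * n + 1) / (n * (n + 1)))
            * (legendre n).derivative.derivative.eval t)) * (![1, 0, 0] i * ![t, 0, -s] j)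
          + (ψ n * ((2 * n + 1) / (n * (n + 1))) * (legendre n).derivative.eval t)
            * (![0, 1, 0] i * ![0, 1, 0] j)) := by
      intro n hn
      have h := sum_surfaceGradient_mul hY n hst i j
      have hn1 : (0 : ℝ) < n := by exact_mod_cast (Finset.mem_Icc.1 hn).1
      have hn2 : (0 : ℝ) < n * (n + 1) := by positivity
      have hsq : (Real.sqrt (n * (n + 1)))⁻¹ * (Real.sqrt (n * (n + 1)))⁻¹ =
          1 / ((n : ℝ) * (n + 1)) := by
        rw [← mul_inv, Real.mul_self_sqrt hn2.le, one_div]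
      rw [Matrix.sum_apply]
      calc _ = ∑ k : Fin (2 * n + 1), (surfaceGradient (Y n k) !₂[0, 0, 1] i *
            surfaceGradient (Y n k) !₂[s, 0, t] j) *
            (ψ n / r ^ 2 * (1 / ((n : ℝ) * (n + 1)))) := by
            refine Finset.sum_congr rfl fun k _ => ?_
            rw [← hsq]
            simp only [tensor, vecHarmonic₂, Matrix.smul_apply, Matrix.of_apply, PiLp.smul_apply,
              smul_eq_mul, one_div]
            ring
        _ = _ := by
            rw [← Finset.sum_mul, h]
            ring
    rw [Finset.sum_congr rfl fun n _ => e1 n, Finset.sum_congr rfl e2, alongProfile_eq]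
    simp only [normalProfile, crossProfile, Polynomial.eval_finsetSum, Polynomial.eval_mul,
      Polynomial.eval_C, Polynomial.eval_sub, Polynomial.eval_X, Polynomial.eval_one,
      Polynomial.eval_pow, Polynomial.derivative_sum, Polynomial.derivative_C_mul,
      ← Finset.mul_sum, ← Finset.sum_mul, Finset.sum_add_distrib, Finset.sum_sub_distrib]
    ring
  simp only [zonalAbsSq, ← hs, tensorAbsSq, hK, Fin.sum_univ_three, profileSq,
    Polynomial.eval_add, Polynomial.eval_pow]
  -- The frames at both points are orthonormal, so the squared entries sum to the squares of the
  -- three coefficients once `s² + t² = 1` is used.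
  simp
  linear_combination (areaInv / r ^ 2) ^ 2 * ((normalProfile L ψ).eval t ^ 2 +
    (alongProfile L ψ).eval t ^ 2) * hst

theorem zonalNormSq_tensorKernel (hY : IsOrthonormalSphericalHarmonics Y) {r : ℝ} (hr : 0 < r)
    (L : ℕ) (ψ : ℕ → ℝ) {b : ℝ} (hb : b ∈ Set.Icc (-1 : ℝ) 1) :
    zonalNormSq r (tensorKernel Y r L ψ) b =
      (areaInv / r ^ 2) ^ 2 * ∫ t in (-1 : ℝ)..b, (profileSq L ψ).eval t := by
  rw [zonalNormSq, ← intervalIntegral.integral_const_mul]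
  refine intervalIntegral.integral_congr fun t ht => ?_
  rw [Set.uIcc_of_le hb.1] at ht
  exact zonalAbsSq_tensorKernel hY hr L ψ ⟨ht.1, ht.2.trans hb.2⟩

end SphericalHarmonic

/-! ### Optimized wavelet kernels -/

namespace SphericalHarmonic

open LegendrePolynomial

theorem tendsto_growthRatio {r R κ δ : ℝ} (hδ : 0 < δ) {β : ℕ → ℝ} {α : ℕ → ℕ → ℝ}
    (h : growthRatio r R κ β α =O[atTop] fun N : ℕ => (N : ℝ) ^ (-2 * (1 + δ))) :
    Tendsto (growthRatio r R κ β α) atTop (𝓝 0) := by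
  refine h.trans_tendsto ?_
  have h1 := (tendsto_rpow_neg_atTop (y := 2 * (1 + δ)) (by positivity)).comp
    (tendsto_natCast_atTop_atTop (R := ℝ))
  refine h1.congr fun N => ?_
  simp only [Function.comp]
  congr 1
  ring

theorem div_le_growthRatio {r R κ : ℝ} (β : ℕ → ℝ) (α : ℕ → ℕ → ℝ) {N n : ℕ}
    (hn : n ≤ ⌊κ * N⌋₊) :
    (β N * ((1 - (R / r) ^ (2 * (N + 1))) / (1 - (R / r) ^ 2)) + ((⌊κ * N⌋₊ : ℝ) + 1) ^ 2)
      / α N n ≤ growthRatio r R κ β α N :=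
  Finset.le_sup' (fun n => (β N * ((1 - (R / r) ^ (2 * (N + 1))) / (1 - (R / r) ^ 2))
    + ((⌊κ * N⌋₊ : ℝ) + 1) ^ 2) / α N n) (Finset.mem_range.2 (by omega))

/-- This geometric sum is the penalty for exact inversion and the source of the first summand in the
numerator of `growthRatio`. -/
theorem sum_inv_singularValue_sq {r R : ℝ} (hr : 0 < r) (hrR : r < R) (N : ℕ) :
    ∑ n ∈ Finset.Icc 0 N, |(singularValue r R n)⁻¹| ^ 2 =
      (R / r) ^ 2 * ((1 - (R / r) ^ (2 * (N + 1))) / (1 - (R / r) ^ 2)) := by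
  have h1 : 1 < R / r := (one_lt_div hr).2 hrR
  have h2 : (R / r) ^ 2 ≠ 1 := by nlinarith
  have h3 : 1 - (R / r) ^ 2 ≠ 0 := sub_ne_zero.2 h2.symm
  have h4 : (R / r) ^ 2 - 1 ≠ 0 := sub_ne_zero.2 h2
  rw [← Nat.range_succ_eq_Icc_zero, pow_mul]
  have h5 : ∀ n, |(singularValue r R n)⁻¹| ^ 2 = (R / r) ^ 2 * ((R / r) ^ 2) ^ n := by
    intro n
    rw [sq_abs, singularValue, ← inv_pow, inv_div]
    ring
  simp only [h5]
  rw [← Finset.mul_sum, geom_sum_eq h2]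
  congr 1
  rw [div_eq_div_iff h4 h3]
  ring

variable {Y : (n : ℕ) → Fin (2 * n + 1) → E3 → ℝ}

theorem zonalNormSq_nonneg {r b : ℝ} (K : E3 → E3 → Matrix (Fin 3) (Fin 3) ℝ)
    (hb : -1 ≤ b) : 0 ≤ zonalNormSq r K b := by
  refine intervalIntegral.integral_nonneg hb fun t _ => ?_
  rw [zonalAbsSq, tensorAbsSq]
  positivity

theorem integral_profileSq_mono (L : ℕ) (ψ : ℕ → ℝ) {b : ℝ} (hb : b ∈ Set.Icc (-1 : ℝ) 1) :
    ∫ t in (-1 : ℝ)..b, (profileSq L ψ).eval t ≤ integralUnit (profileSq L ψ) :=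
  intervalIntegral.integral_mono_interval le_rfl hb.1 hb.2
    (Filter.Eventually.of_forall (profileSq_eval_nonneg L ψ)) (intervalIntegrable_eval _ _ _)

/-- The constant in the bound for the minimum of the functional. -/
noncomputable def minConst (r R : ℝ) : ℝ :=
  (R / r) ^ 2 + 8 * Real.pi ^ 2 * r ^ 4 * ((areaInv / r ^ 2) ^ 2 * 21)

/-- The minimum of the functional is at most its value at the sharp bandpass symbols. -/
theorem kernelFunctional_minimizer_le (hY : IsOrthonormalSphericalHarmonics Y)
    {r R ρ κ : ℝ} (hr : 0 < r) (hrR : r < R) (hρ : ρ ∈ Set.Ioo (0 : ℝ) 2) (hκ : 1 < κ) (N : ℕ)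
    {α αt : ℕ → ℝ} {β : ℝ} (hβ : 0 < β) {φ φt : ℕ → ℝ}
    (hmin : IsMinimizer Y r R ρ κ N α αt β φ φt) :
    kernelFunctional Y r R ρ κ N α αt β φ φt ≤ minConst r R *
      (β * ((1 - (R / r) ^ (2 * (N + 1))) / (1 - (R / r) ^ 2)) + ((⌊κ * N⌋₊ : ℝ) + 1) ^ 2) := by
  set L := ⌊κ * N⌋₊ with hL
  have hNL : N ≤ L := Nat.le_floor (le_mul_of_one_le_left (Nat.cast_nonneg N) hκ.le)
  have hσ : ∀ n, singularValue r R n ≠ 0 := fun n =>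
    (pow_pos (div_pos hr (hr.trans hrR)) _).ne'
  -- With exact inversion up to `N` and `φt₀ = 1` up to `L`, the wavelet symbol is the indicator of
  -- `N < n ≤ L`.
  let φ₀ : ℕ → ℝ := fun n => if n ≤ N then (singularValue r R n)⁻¹ else 0
  let φt₀ : ℕ → ℝ := fun n => if n ≤ L then 1 else 0
  have hadm : (φ₀, φt₀) ∈ admissibleSymbols κ N :=
    ⟨fun n hn => if_neg (by omega), fun n hn => if_neg (not_le.2 hn)⟩
  refine (isMinOn_iff.1 hmin.2 _ hadm).trans ?_
  have hb : 1 - ρ ∈ Set.Icc (-1 : ℝ) 1 := ⟨by linarith [hρ.2], by linarith [hρ.1]⟩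
  have hψ : ∀ n ≤ L, |waveletSymbol r R φ₀ φt₀ n| ≤ 1 := by
    intro n hn
    by_cases h : n ≤ N
    · simp [waveletSymbol, φ₀, φt₀, h, hn, hσ]
    · simp [waveletSymbol, φ₀, φt₀, h, hn]
  -- The bound without localization is enough, since `growthRatio` already contains `(L + 1)²`.
  have hz : zonalNormSq r (waveletKernel Y r R κ N φ₀ φt₀) (1 - ρ) ≤
      (areaInv / r ^ 2) ^ 2 * 21 * ((L : ℝ) + 1) ^ 2 := by
    rw [waveletKernel, zonalNormSq_tensorKernel hY hr _ _ hb, mul_assoc]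
    gcongr
    refine (integral_profileSq_mono _ _ hb).trans ((integral_profileSq_le L hψ).trans ?_)
    simp
  have h1 : ∑ n ∈ Finset.Icc 0 L, αt n * |1 - φt₀ n| ^ 2 = 0 := by
    refine Finset.sum_eq_zero fun n hn => ?_
    simp [φt₀, (Finset.mem_Icc.1 hn).2]
  have h2 : ∑ n ∈ Finset.Icc 0 N, α n * |1 - φ₀ n * singularValue r R n| ^ 2 = 0 := by
    refine Finset.sum_eq_zero fun n hn => ?_
    simp [φ₀, (Finset.mem_Icc.1 hn).2, hσ]
  have h3 : ∑ n ∈ Finset.Icc 0 N, |φ₀ n| ^ 2 =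
      (R / r) ^ 2 * ((1 - (R / r) ^ (2 * (N + 1))) / (1 - (R / r) ^ 2)) := by
    rw [← sum_inv_singularValue_sq hr hrR]
    refine Finset.sum_congr rfl fun n hn => ?_
    simp [φ₀, (Finset.mem_Icc.1 hn).2]
  have hpos : 0 ≤ (1 - (R / r) ^ (2 * (N + 1))) / (1 - (R / r) ^ 2) := by
    have h4 : 0 ≤ ∑ n ∈ Finset.Icc 0 N, |φ₀ n| ^ 2 := Finset.sum_nonneg fun n _ => by positivity
    rw [h3] at h4
    have h5 : 0 < (R / r) ^ 2 := pow_pos (div_pos (hr.trans hrR) hr) 2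
    exact nonneg_of_mul_nonneg_right h4 h5
  simp only [kernelFunctional]
  rw [← hL, h1, h2, h3, minConst]
  generalize (1 - (R / r) ^ (2 * (N + 1))) / (1 - (R / r) ^ 2) = g at hpos
  have hz' := mul_le_mul_of_nonneg_left hz (show 0 ≤ 8 * Real.pi ^ 2 * r ^ 4 by positivity)
  have h6 : 0 ≤ 8 * Real.pi ^ 2 * r ^ 4 * ((areaInv / r ^ 2) ^ 2 * 21) * (β * g) := by
    have := mul_nonneg hβ.le hpos
    positivity
  have h7 : 0 ≤ (R / r) ^ 2 * ((L : ℝ) + 1) ^ 2 := by positivity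
  linarith

theorem sq_le_of_mul_le {a x C num F G : ℝ} (ha : 0 < a) (hC : 0 ≤ C) (h1 : a * |x| ^ 2 ≤ F)
    (h2 : F ≤ C * num) (h3 : num / a ≤ G) : x ^ 2 ≤ C * G := by
  rw [sq_abs] at h1
  calc x ^ 2 = a * x ^ 2 / a := by field_simp
    _ ≤ C * num / a := div_le_div_of_nonneg_right (h1.trans h2) ha.le
    _ = C * (num / a) := by ring
    _ ≤ C * G := by gcongr

/-- The minimizing symbols are uniformly close to those of the sharp bandpass filter. -/
theorem sq_waveletSymbol_sub_sharpSymbol_le (hY : IsOrthonormalSphericalHarmonics Y)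
    {r R ρ κ : ℝ} (hr : 0 < r) (hrR : r < R) (hρ : ρ ∈ Set.Ioo (0 : ℝ) 2) (hκ : 1 < κ) (N : ℕ)
    {α αt : ℕ → ℕ → ℝ} {β : ℕ → ℝ} (hα : ∀ n ≤ ⌊κ * N⌋₊, 0 < α N n)
    (hαt : ∀ n ≤ ⌊κ * N⌋₊, 0 < αt N n) (hβ : 0 < β N) {φ φt : ℕ → ℝ}
    (hmin : IsMinimizer Y r R ρ κ N (α N) (αt N) (β N) φ φt) {n : ℕ} (hn : n ≤ ⌊κ * N⌋₊) :
    (waveletSymbol r R φ φt n - sharpSymbol N n) ^ 2 ≤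
      2 * minConst r R * (growthRatio r R κ β α N + growthRatio r R κ β αt N) := by
  have hF := kernelFunctional_minimizer_le hY hr hrR hρ hκ N hβ hmin
  set L := ⌊κ * N⌋₊ with hL
  have hNL : N ≤ L := Nat.le_floor (le_mul_of_one_le_left (Nat.cast_nonneg N) hκ.le)
  have hC : 0 ≤ minConst r R := by
    rw [minConst]
    positivity
  have hz : 0 ≤ 8 * Real.pi ^ 2 * r ^ 4 *
      zonalNormSq r (waveletKernel Y r R κ N φ φt) (1 - ρ) :=
    mul_nonneg (by positivity) (zonalNormSq_nonneg _ (by linarith [hρ.2]))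
  have t1 : ∀ m ∈ Finset.Icc 0 L, 0 ≤ αt N m * |1 - φt m| ^ 2 := fun m hm =>
    mul_nonneg (hαt m (Finset.mem_Icc.1 hm).2).le (by positivity)
  have t2 : ∀ m ∈ Finset.Icc 0 N, 0 ≤ α N m * |1 - φ m * singularValue r R m| ^ 2 := fun m hm =>
    mul_nonneg (hα m ((Finset.mem_Icc.1 hm).2.trans hNL)).le (by positivity)
  have s1 := Finset.sum_nonneg t1
  have s2 := Finset.sum_nonneg t2
  have s3 : 0 ≤ β N * ∑ m ∈ Finset.Icc 0 N, |φ m| ^ 2 :=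
    mul_nonneg hβ.le (Finset.sum_nonneg fun m _ => by positivity)
  have hFt : ∀ m ≤ L, (1 - φt m) ^ 2 ≤ minConst r R * growthRatio r R κ β αt N := by
    intro m hm
    refine sq_le_of_mul_le (hαt m hm) hC ?_ hF (div_le_growthRatio β αt hm)
    have := Finset.single_le_sum t1 (Finset.mem_Icc.2 ⟨Nat.zero_le m, hm⟩)
    simp only [kernelFunctional]
    linarith
  have hFφ : ∀ m ≤ N, (1 - φ m * singularValue r R m) ^ 2 ≤
      minConst r R * growthRatio r R κ β α N := by
    intro m hm
    refine sq_le_of_mul_le (hα m (hm.trans hNL)) hC ?_ hF (div_le_growthRatio β α (hm.trans hNL))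
    have := Finset.single_le_sum t2 (Finset.mem_Icc.2 ⟨Nat.zero_le m, hm⟩)
    simp only [kernelFunctional]
    linarith
  have g0 := (sq_nonneg _).trans (hFφ 0 (Nat.zero_le N))
  -- Above `N` the symbol `φ n` is zero by admissibility and only the error of `φt` remains. Up to
  -- `N` the deviation is a difference of two errors, which accounts for the factor `2`.
  by_cases h : N < n
  · have h1 : waveletSymbol r R φ φt n - sharpSymbol N n = -(1 - φt n) := by
      rw [waveletSymbol, sharpSymbol, if_pos h, show φ n = 0 from hmin.1.1 n h]
      ring
    rw [h1, neg_sq]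
    linarith [hFt n hn, sq_nonneg (1 - φt n)]
  · have h1 : waveletSymbol r R φ φt n - sharpSymbol N n =
        (1 - φ n * singularValue r R n) - (1 - φt n) := by
      rw [waveletSymbol, sharpSymbol, if_neg h]
      ring
    rw [h1]
    have := hFt n hn
    have := hFφ n (not_lt.1 h)
    nlinarith [sq_nonneg ((1 - φ n * singularValue r R n) + (1 - φt n))]

/-! ### Asymptotics of the numerator and the denominator -/

theorem sum_Ioc_odd {N L : ℕ} (h : N ≤ L) :
    ∑ n ∈ Finset.Icc (N + 1) L, (2 * (n : ℝ) + 1) = ((L : ℝ) + 1) ^ 2 - ((N : ℝ) + 1) ^ 2 := by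
  rw [← sum_Icc_zero_odd L, ← sum_Icc_zero_odd N, eq_sub_iff_add_eq, add_comm,
    ← Nat.range_succ_eq_Icc_zero, ← Nat.range_succ_eq_Icc_zero]
  exact Finset.sum_range_add_sum_Ico _ (by omega : N + 1 ≤ L + 1)

/-- The normal part alone suffices: in the band `ψ n ≥ 1/2`, so each term of its Parseval sum is at
least `(2n+1)/2`. -/
theorem le_integral_profileSq {N L : ℕ} (hNL : N ≤ L) {ψ : ℕ → ℝ}
    (hψ : ∀ n ≤ L, |ψ n - sharpSymbol N n| ≤ 1 / 2) :
    (((L : ℝ) + 1) ^ 2 - ((N : ℝ) + 1) ^ 2) / 2 ≤ integralUnit (profileSq L ψ) := by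
  have h1 : integralUnit (normalProfile L ψ ^ 2) ≤ integralUnit (profileSq L ψ) := by
    refine LegendrePolynomial.integral_mono fun t _ => ?_
    simp only [profileSq, Polynomial.eval_add, Polynomial.eval_pow]
    nlinarith [sq_nonneg ((crossProfile L ψ).eval t), sq_nonneg ((alongProfile L ψ).eval t)]
  refine le_trans ?_ h1
  rw [integral_normalProfile_sq, ← sum_Ioc_odd hNL, Finset.sum_div]
  calc _ ≤ ∑ n ∈ Finset.Icc (N + 1) L, 2 * (2 * (n : ℝ) + 1) * ψ n ^ 2 := by
        refine Finset.sum_le_sum fun n hn => ?_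
        have h2 := hψ n (Finset.mem_Icc.1 hn).2
        rw [sharpSymbol, if_pos (show N < n from (Finset.mem_Icc.1 hn).1)] at h2
        have h3 : 1 / 4 ≤ ψ n ^ 2 := by nlinarith [(abs_le.1 h2).1]
        have h4 : (0 : ℝ) < 2 * n + 1 := by positivity
        nlinarith
    _ ≤ _ := Finset.sum_le_sum_of_subset_of_nonneg
        (Finset.Icc_subset_Icc (Nat.zero_le _) le_rfl) fun n _ _ => by positivity

/-- The indicator part is localized and costs `2 · 120/ρ²` times `L + 1`; the deviation is estimated
over all of `[-1, 1]` and costs `2 · 21 m²` times `(L + 1)²`. -/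
theorem integral_Icc_profileSq_le {ρ : ℝ} (hρ : ρ ∈ Set.Ioo (0 : ℝ) 2) {N L : ℕ} (hNL : N ≤ L)
    {ψ : ℕ → ℝ} {m : ℝ} (hψ : ∀ n ≤ L, |ψ n - sharpSymbol N n| ≤ m) :
    ∫ t in (-1 : ℝ)..(1 - ρ), (profileSq L ψ).eval t ≤
      240 / ρ ^ 2 * ((L : ℝ) + 1) + 42 * m ^ 2 * ((L : ℝ) + 1) ^ 2 := by
  have hb : 1 - ρ ∈ Set.Icc (-1 : ℝ) 1 := ⟨by linarith [hρ.2], by linarith [hρ.1]⟩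
  have h1 : ψ = fun n => sharpSymbol N n + (ψ n - sharpSymbol N n) := by
    ext n
    ring
  have h2 : ∫ t in (-1 : ℝ)..(1 - ρ), (profileSq L ψ).eval t ≤ ∫ t in (-1 : ℝ)..(1 - ρ),
      (2 * (profileSq L (sharpSymbol N)).eval t
        + 2 * (profileSq L fun n => ψ n - sharpSymbol N n).eval t) := by
    refine intervalIntegral.integral_mono_on hb.1 (intervalIntegrable_eval _ _ _)
      (((intervalIntegrable_eval _ _ _).const_mul _).add
        ((intervalIntegrable_eval _ _ _).const_mul _)) fun t _ => ?_
    conv_lhs => rw [h1]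
    exact profileSq_eval_add_le _ _ _ _
  rw [intervalIntegral.integral_add ((intervalIntegrable_eval _ _ _).const_mul _)
    ((intervalIntegrable_eval _ _ _).const_mul _), intervalIntegral.integral_const_mul,
    intervalIntegral.integral_const_mul] at h2
  have h3 := integral_profileSq_sharp_le hρ hNL
  have h4 := (integral_profileSq_mono L (fun n => ψ n - sharpSymbol N n) hb).trans
    (integral_profileSq_le L hψ)
  have h5 : 240 / ρ ^ 2 * ((L : ℝ) + 1) = 2 * (120 / ρ ^ 2 * ((L : ℝ) + 1)) := by ring
  linarith

theorem eventually_sq_gap {κ : ℝ} (hκ : 1 < κ) : ∀ᶠ N : ℕ in atTop, 0 < N ∧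
    (κ ^ 2 - 1) / 2 * (N : ℝ) ^ 2 ≤ ((⌊κ * N⌋₊ : ℝ) + 1) ^ 2 - ((N : ℝ) + 1) ^ 2 := by
  have hκ2 : 0 < κ ^ 2 - 1 := by nlinarith
  -- Since `L + 1 ≥ κN` and `(N+1)² ≤ N² + 3N`, the gap is at least `(κ² - 1)N² - 3N`; the threshold
  -- `6/(κ² - 1)` lets half of the first term absorb `3N`.
  filter_upwards [eventually_gt_atTop 0,
    (tendsto_natCast_atTop_atTop (R := ℝ)).eventually_ge_atTop (6 / (κ ^ 2 - 1))] with N h0 h1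
  refine ⟨h0, ?_⟩
  have hN : (1 : ℝ) ≤ N := by exact_mod_cast h0
  have h2 := (Nat.lt_floor_add_one (κ * N)).le
  have h3 : (κ * N) ^ 2 ≤ ((⌊κ * N⌋₊ : ℝ) + 1) ^ 2 := by gcongr
  rw [div_le_iff₀ hκ2] at h1
  nlinarith

end SphericalHarmonic

open SphericalHarmonic LegendrePolynomial in
theorem lemma6p5
    (Y : (n : ℕ) → Fin (2 * n + 1) → E3 → ℝ) (hY : IsOrthonormalSphericalHarmonics Y)
    (r R ρ κ δ : ℝ) (hr : 0 < r) (hrR : r < R) (hρ : ρ ∈ Set.Ioo (0 : ℝ) 2)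
    (hκ : 1 < κ) (hδ : 0 < δ)
    (α αt : ℕ → ℕ → ℝ) (β : ℕ → ℝ)
    (hα : ∀ (N n : ℕ), n ≤ ⌊κ * N⌋₊ → 0 < α N n) (hαt : ∀ (N n : ℕ), n ≤ ⌊κ * N⌋₊ → 0 < αt N n)
    (hβ : ∀ N, 0 < β N)
    (hgrowth : growthRatio r R κ β α =O[atTop] fun N : ℕ => (N : ℝ) ^ (-2 * (1 + δ)))
    (hgrowtht : growthRatio r R κ β αt =O[atTop] fun N : ℕ => (N : ℝ) ^ (-2 * (1 + δ)))
    (φ φt : ℕ → ℕ → ℝ)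
    (hmin : ∀ N, IsMinimizer Y r R ρ κ N (α N) (αt N) (β N) (φ N) (φt N)) :
    (∀ᶠ N : ℕ in atTop, 0 < zonalNormSq r (waveletKernel Y r R κ N (φ N) (φt N)) 1) ∧
    Tendsto (fun N : ℕ =>
        zonalNormSq r (waveletKernel Y r R κ N (φ N) (φt N)) (1 - ρ) /
          zonalNormSq r (waveletKernel Y r R κ N (φ N) (φt N)) 1)
      atTop (𝓝 0) := by
  have hb : 1 - ρ ∈ Set.Icc (-1 : ℝ) 1 := ⟨by linarith [hρ.2], by linarith [hρ.1]⟩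
  have hκ2 : 0 < κ ^ 2 - 1 := by nlinarith
  have hA : 0 < (areaInv / r ^ 2) ^ 2 := by
    have := areaInv_pos
    positivity
  set ε : ℕ → ℝ := fun N =>
    2 * minConst r R * (growthRatio r R κ β α N + growthRatio r R κ β αt N) with hε
  have hε0 : Tendsto ε atTop (𝓝 0) := by
    simpa using ((tendsto_growthRatio hδ hgrowth).add
      (tendsto_growthRatio hδ hgrowtht)).const_mul (2 * minConst r R)
  set ψ : ℕ → ℕ → ℝ := fun N => waveletSymbol r R (φ N) (φt N) with hψ
  have hdev : ∀ N : ℕ, ∀ n ≤ ⌊κ * N⌋₊, (ψ N n - sharpSymbol N n) ^ 2 ≤ ε N := fun N n hn =>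
    sq_waveletSymbol_sub_sharpSymbol_le hY hr hrR hρ hκ N (hα N) (hαt N) (hβ N) (hmin N) hn
  have hεn : ∀ N, 0 ≤ ε N := fun N => (sq_nonneg _).trans (hdev N 0 (Nat.zero_le _))
  have hNL : ∀ N : ℕ, N ≤ ⌊κ * N⌋₊ := fun N =>
    Nat.le_floor (le_mul_of_one_le_left (Nat.cast_nonneg N) hκ.le)
  have hlow : ∀ᶠ N : ℕ in atTop, 0 < N ∧
      (κ ^ 2 - 1) / 4 * (N : ℝ) ^ 2 ≤ integralUnit (profileSq ⌊κ * N⌋₊ (ψ N)) := by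
    -- Once `ε N ≤ 1/4` the symbols are within `1/2` of the indicator.
    filter_upwards [eventually_sq_gap hκ, hε0.eventually_le_const
      (show (0 : ℝ) < (1 / 2) ^ 2 by norm_num)] with N h1 h2
    refine ⟨h1.1, ?_⟩
    have h3 := le_integral_profileSq (hNL N) (ψ := ψ N) fun n hn =>
      abs_le_of_sq_le_sq ((hdev N n hn).trans h2) (by norm_num)
    linarith [h1.2]
  have hden : ∀ N : ℕ, zonalNormSq r (waveletKernel Y r R κ N (φ N) (φt N)) 1 =
      (areaInv / r ^ 2) ^ 2 * integralUnit (profileSq ⌊κ * N⌋₊ (ψ N)) := fun N =>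
    zonalNormSq_tensorKernel hY hr _ _ (by norm_num)
  have hnum : ∀ N : ℕ, zonalNormSq r (waveletKernel Y r R κ N (φ N) (φt N)) (1 - ρ) =
      (areaInv / r ^ 2) ^ 2 * ∫ t in (-1 : ℝ)..(1 - ρ), (profileSq ⌊κ * N⌋₊ (ψ N)).eval t :=
    fun N => zonalNormSq_tensorKernel hY hr _ _ hb
  refine ⟨?_, ?_⟩
  · filter_upwards [hlow] with N hN
    rw [hden]
    have h1 : (0 : ℝ) < N := by exact_mod_cast hN.1
    have h2 : 0 < integralUnit (profileSq ⌊κ * N⌋₊ (ψ N)) :=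
      lt_of_lt_of_le (by positivity) hN.2
    positivity
  -- The majorant is the numerator bound with `L + 1 ≤ (κ + 1)N` and `m² = ε N`, divided by the
  -- quadratic lower bound of the denominator.
  · have hlim : Tendsto (fun N : ℕ => (240 / ρ ^ 2 * (κ + 1) * (N : ℝ)⁻¹
        + 42 * ε N * (κ + 1) ^ 2) / ((κ ^ 2 - 1) / 4)) atTop (𝓝 0) := by
      have h1 := (tendsto_inv_atTop_nhds_zero_nat (𝕜 := ℝ)).const_mul (240 / ρ ^ 2 * (κ + 1))
      have h2 := (hε0.const_mul 42).mul_const ((κ + 1) ^ 2)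
      simpa using (h1.add h2).div_const ((κ ^ 2 - 1) / 4)
    refine squeeze_zero' (Eventually.of_forall fun N => div_nonneg
      (zonalNormSq_nonneg _ hb.1) (zonalNormSq_nonneg _ (by norm_num))) ?_ hlim
    filter_upwards [hlow] with N hN
    rw [hden, hnum, mul_div_mul_left _ _ hA.ne']
    have h1 : (1 : ℝ) ≤ N := by exact_mod_cast hN.1
    have hNpos : (0 : ℝ) < N := by linarith
    have h2 := integral_Icc_profileSq_le hρ (hNL N) (ψ := ψ N) (m := Real.sqrt (ε N))
      fun n hn => Real.abs_le_sqrt (hdev N n hn)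
    rw [Real.sq_sqrt (hεn N)] at h2
    have h3 : ((⌊κ * N⌋₊ : ℝ) + 1) ≤ (κ + 1) * N := by
      have := Nat.floor_le (show 0 ≤ κ * N by positivity)
      linarith
    have hε1 := hεn N
    have h4 : 240 / ρ ^ 2 * ((⌊κ * N⌋₊ : ℝ) + 1) + 42 * ε N * ((⌊κ * N⌋₊ : ℝ) + 1) ^ 2 ≤
        240 / ρ ^ 2 * ((κ + 1) * N) + 42 * ε N * ((κ + 1) * N) ^ 2 := by gcongr
    have h5 : 0 < (κ ^ 2 - 1) / 4 * (N : ℝ) ^ 2 := by positivity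
    calc _ ≤ (240 / ρ ^ 2 * ((κ + 1) * N) + 42 * ε N * ((κ + 1) * N) ^ 2)
          / ((κ ^ 2 - 1) / 4 * (N : ℝ) ^ 2) := by
          have := hρ.1
          gcongr
          · exact h2.trans h4
          · exact hN.2
      _ = _ := by field_simp
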